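/- **Theorem ($w_\rho$ is an algebra map).** A *unitrivalent diagram* is a finite graph $D$ with oriented trivalent vertices (cyclic order of the three half-edges) and univalent vertices (*legs*) attached at distinct points of an oriented circle, such that graph and circle together are connected; its degree is half its number of vertices. Let ${}^f\!\mathcal A=\prod_{n\ge 0}{}^f\!\mathcal A_n$, where ${}^f\!\mathcal A_n$ is the $\mathbb Q$-vector space spanned by the diagrams of degree $n$ modulo the STU relations, and let $\mathcal A=\prod_{n\ge 0}\mathcal A_n$ be its quotient by the 1T relation (a diagram with an isolated chord is $0$); both are $\mathbb Q$-algebras under connected sum. Let $K$ be an algebraically closed field of characteristic $0$, $\mathfrak g$ a finite-dimensional Lie algebra over $K$ with a nondegenerate symmetric invariant bilinear form $B$, and $\rho\colon\mathfrak g\to\operatorname{End}_K(V)$ a finite-dimensional irreducible representation. For a diagram $D$ let $w^{f}_{\mathfrak g}(D)\in U(\mathfrak g)$ be the element obtained by placing on each edge the tensor $\sum_i b_i\otimes b^i$ (for a basis $(b_i)$ of $\mathfrak g$ and its $B$-dual basis $(b^i)$), at each trivalent vertex the form $(x,y,z)\mapsto B([x,y],z)$, contracting, and multiplying the vectors at the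 legs in their order along the circle from some base point. Let $\Theta$ be the diagram with a single chord, so that $C=w^f_{\mathfrak g}(\Theta)$ is the Casimir element, and put $$w_{\mathfrak g}(D)=\sum_{S}(-C)^{|S|}\,w^{f}_{\mathfrak g}(D\smallsetminus S),$$ the sum being over all sets $S$ of chords of $D$ (edges with both ends on the circle); thus $w_{\mathfrak g}(D)=w^f_{\mathfrak g}(D)$ if $D$ has no chords. Then: 1. $w_{\mathfrak g}$ does not depend on the choices and extends to a well-defined $\mathbb Q$-linear map from the space $\bigoplus_n\mathcal A_n$ of finite combinations of diagrams to $U(\mathfrak g)$, with values in the centre of $U(\mathfrak g)$. For $a=\sum_n a_n\in\mathcal A$ with $a_n\in\mathcal A_n$, each $w_{\mathfrak g}(a_n)$ acts on $V$ by a scalar $s(a_n)\in K$, and the map $$w_\rho\colon\mathcal A\to K[[h]],\qquad w_\rho(a)=\sum_n s(a_n)h^n$$ is a homomorphism of $\mathbb Q$-algebras. If $(\mathfrak g,B,V)$ is defined over $\mathbb Q$ (in suitable bases of $\mathfrak g$ and $V$ the structure constants of $\mathfrak g$, the values of $B$ and the matrices of $\rho$ are rational), then $w_\rho$ takes values in $\mathbb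 Q[[h]]$, so that $w_\rho\colon\mathcal A\to\mathbb Q[[h]]$ is a $\mathbb Q$-algebra homomorphism. 2. The same holds with ${}^f\!\mathcal A$ and $w^f_{\mathfrak g}$ in place of $\mathcal A$ and $w_{\mathfrak g}$. -/

import Mathlib

/-! Unitrivalent (Jacobi) diagrams on an oriented circle, cut open at a base point, the algebra they
generate, and the weight systems of a Lie algebra with an invariant form. -/

/-- A half-edge `(e, s)`: the end `s` of the edge named `e`. -/
abbrev HalfEdge : Type := ℕ × Bool

/-- The other end of the edge. -/
def HalfEdge.opp (x : HalfEdge) : HalfEdge := (x.1, !x.2)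

/-- A trivalent vertex: its three half-edges, the vertex being oriented by their cyclic order. -/
abbrev TriVertex : Type := HalfEdge × HalfEdge × HalfEdge

/-- The three half-edges at a trivalent vertex. -/
def TriVertex.ends (v : TriVertex) : List HalfEdge := [v.1, v.2.1, v.2.2]

/-- All the half-edges: those ending on the skeleton and those at the trivalent vertices. -/
def allEnds (legs : List HalfEdge) (verts : List TriVertex) : List HalfEdge :=
  legs ++ verts.flatMap TriVertex.ends

/-- Two half-edges are linked when they belong to one edge or to one trivalent vertex. -/
def Linked (verts : List TriVertex) (x y : HalfEdge) : Prop :=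
  y = x.opp ∨ ∃ v ∈ verts, x ∈ v.ends ∧ y ∈ v.ends

/-- A unitrivalent diagram on the oriented circle with a base point (which is not a leg): `legs`
lists the half-edges that end on the circle, in the order in which they are met from the base point,
and `verts` lists the oriented trivalent vertices. -/
structure UTDiagram where
  /-- half-edges attached to the skeleton, in order -/
  legs : List HalfEdge
  /-- oriented trivalent vertices -/
  verts : List TriVertex
  /-- every half-edge ends at one place only -/
  nodup : (allEnds legs verts).Nodup
  /-- every edge has both its ends in the diagram -/
  closed : ∀ x ∈ allEnds legs verts, x.opp ∈ allEnds legs verts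
  /-- the diagram together with the skeleton is connected -/
  connected : ∀ x ∈ allEnds legs verts, ∃ y ∈ legs, Relation.ReflTransGen (Linked verts) x y

/-- The degree is half the number of vertices, univalent and trivalent. -/
def UTDiagram.HasDegree (D : UTDiagram) (n : ℕ) : Prop :=
  D.legs.length + D.verts.length = 2 * n

/-- Renaming of the half-edges at a vertex. -/
def TriVertex.rename (f : HalfEdge → HalfEdge) (v : TriVertex) : TriVertex :=
  (f v.1, f v.2.1, f v.2.2)

/-- Equality of oriented vertices: equality up to a cyclic rotation. -/
def TriVertex.CycEq (v w : TriVertex) : Prop :=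
  w = v ∨ w = (v.2.1, v.2.2, v.1) ∨ w = (v.2.2, v.1, v.2.1)

/-- Isomorphism of diagrams: half-edges are renamed, the ends of an edge staying together, and the
trivalent vertices may be listed in another order and rotated. -/
def UTDiagram.Iso (D D' : UTDiagram) : Prop :=
  ∃ f : HalfEdge → HalfEdge, Function.Injective f ∧ (∀ x, f x.opp = (f x).opp) ∧
    D'.legs = D.legs.map f ∧
    ∃ vs : List TriVertex, vs.Perm D'.verts ∧
      List.Forall₂ TriVertex.CycEq (D.verts.map (TriVertex.rename f)) vs

/-- The relations between diagrams. The proposition `oneT` says whether the 1T relation is imposed.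
* `iso`: isomorphic diagrams are equal;
* `one`, `mul`: the product is the connected sum, with the empty diagram as unit (`nodup` for `D`
  says that no edge of `D₁` bears the name of an edge of `D₂`);
* `basePoint`: the base point may be moved past a leg;
* `stu`: a leg that leads to a vertex `(a, b, c)` with `a` on the side of the leg equals the
  difference of the two ways of attaching `b` and `c` to the skeleton in its place;
* `isolated`: a diagram with an isolated chord vanishes. -/
inductive DiagRel (oneT : Prop) : FreeAlgebra ℚ UTDiagram → FreeAlgebra ℚ UTDiagram → Prop
  | iso (D D' : UTDiagram) (h : D.Iso D') :
      DiagRel oneT (FreeAlgebra.ι ℚ D) (FreeAlgebra.ι ℚ D')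
  | one (D : UTDiagram) (hl : D.legs = []) (hv : D.verts = []) :
      DiagRel oneT (FreeAlgebra.ι ℚ D) 1
  | mul (D₁ D₂ D : UTDiagram) (hl : D.legs = D₁.legs ++ D₂.legs)
      (hv : D.verts = D₁.verts ++ D₂.verts) :
      DiagRel oneT (FreeAlgebra.ι ℚ D₁ * FreeAlgebra.ι ℚ D₂) (FreeAlgebra.ι ℚ D)
  | basePoint (D D' : UTDiagram) (x : HalfEdge) (l : List HalfEdge) (hl : D.legs = x :: l)
      (hl' : D'.legs = l ++ [x]) (hv : D'.verts = D.verts) :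
      DiagRel oneT (FreeAlgebra.ι ℚ D) (FreeAlgebra.ι ℚ D')
  | stu (S T U : UTDiagram) (l₁ l₂ : List HalfEdge) (a b c : HalfEdge) (vs : List TriVertex)
      (hS : S.legs = l₁ ++ a.opp :: l₂) (hS' : S.verts = (a, b, c) :: vs)
      (hT : T.legs = l₁ ++ b :: c :: l₂) (hT' : T.verts = vs)
      (hU : U.legs = l₁ ++ c :: b :: l₂) (hU' : U.verts = vs) :
      DiagRel oneT (FreeAlgebra.ι ℚ S) (FreeAlgebra.ι ℚ T - FreeAlgebra.ι ℚ U)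
  | isolated (h : oneT) (D : UTDiagram) (l₁ l₂ : List HalfEdge) (x : HalfEdge)
      (hl : D.legs = l₁ ++ x :: x.opp :: l₂) :
      DiagRel oneT (FreeAlgebra.ι ℚ D) 0

/-- The algebra of finite rational combinations of diagrams modulo STU and, if `oneT`, 1T. -/
abbrev DiagAlg (oneT : Prop) : Type := RingQuot (DiagRel oneT)

/-- The class of a diagram. -/
noncomputable def DiagAlg.of (oneT : Prop) (D : UTDiagram) : DiagAlg oneT :=
  RingQuot.mkAlgHom ℚ (DiagRel oneT) (FreeAlgebra.ι ℚ D)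

/-- The homogeneous part of degree `n`. -/
noncomputable def DiagAlg.part (oneT : Prop) (n : ℕ) : Submodule ℚ (DiagAlg oneT) :=
  Submodule.span ℚ {x | ∃ D : UTDiagram, D.HasDegree n ∧ DiagAlg.of oneT D = x}

/-! ### The product respects the grading -/

theorem allEnds_map (f : HalfEdge → HalfEdge) (legs : List HalfEdge) (verts : List TriVertex) :
    allEnds (legs.map f) (verts.map (TriVertex.rename f)) = (allEnds legs verts).map f := by
  simp only [allEnds, List.map_append, List.map_flatMap, List.flatMap_map]
  rfl

theorem mem_allEnds_append {l₁ l₂ : List HalfEdge} {v₁ v₂ : List TriVertex} {x : HalfEdge} :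
    x ∈ allEnds (l₁ ++ l₂) (v₁ ++ v₂) ↔ x ∈ allEnds l₁ v₁ ∨ x ∈ allEnds l₂ v₂ := by
  simp only [allEnds, List.mem_append, List.flatMap_append]
  tauto

theorem allEnds_append_perm (l₁ l₂ : List HalfEdge) (v₁ v₂ : List TriVertex) :
    (allEnds l₁ v₁ ++ allEnds l₂ v₂).Perm (allEnds (l₁ ++ l₂) (v₁ ++ v₂)) := by
  classical
  rw [List.perm_iff_count]
  intro a
  simp only [allEnds, List.count_append, List.flatMap_append]
  omega

theorem Linked.mono {v w : List TriVertex} (h : ∀ t ∈ v, t ∈ w) {x y : HalfEdge}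
    (hl : Linked v x y) : Linked w x y := by
  rcases hl with hl | ⟨t, ht, hx⟩
  · exact Or.inl hl
  · exact Or.inr ⟨t, h t ht, hx⟩

theorem Linked.rename {v : List TriVertex} {f : HalfEdge → HalfEdge}
    (ho : ∀ x : HalfEdge, f x.opp = (f x).opp) {x y : HalfEdge} (hl : Linked v x y) :
    Linked (v.map (TriVertex.rename f)) (f x) (f y) := by
  rcases hl with rfl | ⟨t, ht, hx, hy⟩
  · exact Or.inl (ho x)
  · exact Or.inr ⟨TriVertex.rename f t, List.mem_map_of_mem ht,
      List.mem_map_of_mem (f := f) hx, List.mem_map_of_mem (f := f) hy⟩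

/-- The diagram with its half-edges renamed. -/
def UTDiagram.rename (D : UTDiagram) (f : HalfEdge → HalfEdge) (hf : Function.Injective f)
    (ho : ∀ x : HalfEdge, f x.opp = (f x).opp) : UTDiagram where
  legs := D.legs.map f
  verts := D.verts.map (TriVertex.rename f)
  nodup := by
    rw [allEnds_map]
    exact D.nodup.map hf
  closed := by
    intro x hx
    rw [allEnds_map] at hx ⊢
    obtain ⟨y, hy, rfl⟩ := List.mem_map.1 hx
    rw [← ho]
    exact List.mem_map_of_mem (D.closed y hy)
  connected := by
    intro x hx
    rw [allEnds_map] at hx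
    obtain ⟨y, hy, rfl⟩ := List.mem_map.1 hx
    obtain ⟨z, hz, hyz⟩ := D.connected y hy
    exact ⟨f z, List.mem_map_of_mem hz, hyz.lift f fun _ _ h => h.rename ho⟩

/-- Two diagrams without common half-edges, one after the other on the skeleton. -/
def UTDiagram.append (D₁ D₂ : UTDiagram)
    (h : ∀ x ∈ allEnds D₁.legs D₁.verts, x ∉ allEnds D₂.legs D₂.verts) : UTDiagram where
  legs := D₁.legs ++ D₂.legs
  verts := D₁.verts ++ D₂.verts
  nodup := (allEnds_append_perm _ _ _ _).nodup_iff.1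
    (List.nodup_append.2 ⟨D₁.nodup, D₂.nodup, fun x hx y hy hxy => h x hx (hxy ▸ hy)⟩)
  closed := by
    intro x hx
    rw [mem_allEnds_append] at hx ⊢
    exact hx.imp (D₁.closed x) (D₂.closed x)
  connected := by
    intro x hx
    rw [mem_allEnds_append] at hx
    rcases hx with hx | hx
    · obtain ⟨z, hz, hxz⟩ := D₁.connected x hx
      exact ⟨z, List.mem_append_left _ hz, Relation.ReflTransGen.mono (fun _ _ h =>
        h.mono fun t ht => List.mem_append_left _ ht) _ _ hxz⟩
    · obtain ⟨z, hz, hxz⟩ := D₂.connected x hx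
      exact ⟨z, List.mem_append_right _ hz, Relation.ReflTransGen.mono (fun _ _ h =>
        h.mono fun t ht => List.mem_append_right _ ht) _ _ hxz⟩

theorem TriVertex.forall₂_cycEq_refl (vs : List TriVertex) : List.Forall₂ TriVertex.CycEq vs vs := by
  induction vs with
  | nil => exact List.Forall₂.nil
  | cons v vs ih => exact List.Forall₂.cons (Or.inl rfl) ih

theorem DiagAlg.of_rename (oneT : Prop) (D : UTDiagram) (f : HalfEdge → HalfEdge)
    (hf : Function.Injective f) (ho : ∀ x : HalfEdge, f x.opp = (f x).opp) :
    DiagAlg.of oneT (D.rename f hf ho) = DiagAlg.of oneT D :=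
  (RingQuot.mkAlgHom_rel ℚ (DiagRel.iso D (D.rename f hf ho)
    ⟨f, hf, ho, rfl, _, List.Perm.refl _, TriVertex.forall₂_cycEq_refl _⟩)).symm

theorem DiagAlg.of_mul_of (oneT : Prop) (D₁ D₂ : UTDiagram) :
    ∃ D : UTDiagram, DiagAlg.of oneT D₁ * DiagAlg.of oneT D₂ = DiagAlg.of oneT D ∧
      D.legs.length = D₁.legs.length + D₂.legs.length ∧
      D.verts.length = D₁.verts.length + D₂.verts.length := by
  let f : HalfEdge → HalfEdge := fun x => (2 * x.1, x.2)
  let g : HalfEdge → HalfEdge := fun x => (2 * x.1 + 1, x.2)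
  have hf : Function.Injective f := by
    rintro ⟨a, b⟩ ⟨c, d⟩ h
    simp only [f, Prod.mk.injEq] at h ⊢
    exact ⟨by omega, h.2⟩
  have hg : Function.Injective g := by
    rintro ⟨a, b⟩ ⟨c, d⟩ h
    simp only [g, Prod.mk.injEq] at h ⊢
    exact ⟨by omega, h.2⟩
  let E₁ := D₁.rename f hf fun _ => rfl
  let E₂ := D₂.rename g hg fun _ => rfl
  have hd : ∀ x ∈ allEnds E₁.legs E₁.verts, x ∉ allEnds E₂.legs E₂.verts := by
    intro x hx hx'
    simp only [E₁, E₂, UTDiagram.rename, allEnds_map, List.mem_map] at hx hx'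
    obtain ⟨y, -, rfl⟩ := hx
    obtain ⟨z, -, hz⟩ := hx'
    simp only [f, g, Prod.mk.injEq] at hz
    omega
  refine ⟨E₁.append E₂ hd, ?_, ?_, ?_⟩
  · rw [← DiagAlg.of_rename oneT D₁ f hf fun _ => rfl, ← DiagAlg.of_rename oneT D₂ g hg fun _ => rfl]
    unfold DiagAlg.of
    rw [← map_mul]
    exact RingQuot.mkAlgHom_rel ℚ (DiagRel.mul E₁ E₂ (E₁.append E₂ hd) rfl rfl)
  · simp [UTDiagram.append, E₁, E₂, UTDiagram.rename]
  · simp [UTDiagram.append, E₁, E₂, UTDiagram.rename]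

theorem DiagAlg.mul_mem_part {oneT : Prop} {m n : ℕ} {x y : DiagAlg oneT}
    (hx : x ∈ DiagAlg.part oneT m) (hy : y ∈ DiagAlg.part oneT n) :
    x * y ∈ DiagAlg.part oneT (m + n) := by
  have key : DiagAlg.part oneT m * DiagAlg.part oneT n ≤ DiagAlg.part oneT (m + n) := by
    rw [DiagAlg.part, DiagAlg.part, Submodule.span_mul_span, Submodule.span_le]
    rintro _ ⟨_, ⟨D₁, h₁, rfl⟩, _, ⟨D₂, h₂, rfl⟩, rfl⟩
    obtain ⟨D, hD, hl, hv⟩ := DiagAlg.of_mul_of oneT D₁ D₂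
    refine Submodule.subset_span ⟨D, ?_, hD.symm⟩
    unfold UTDiagram.HasDegree at *
    omega
  exact key (Submodule.mul_mem_mul hx hy)

theorem DiagAlg.one_mem_part (oneT : Prop) : (1 : DiagAlg oneT) ∈ DiagAlg.part oneT 0 := by
  let D : UTDiagram := ⟨[], [], by simp [allEnds], by simp [allEnds], by simp [allEnds]⟩
  refine Submodule.subset_span ⟨D, rfl, ?_⟩
  have h := RingQuot.mkAlgHom_rel ℚ (DiagRel.one (oneT := oneT) D rfl rfl)
  rwa [map_one] at h

/-- The degree completion: the formal series `∑ aₙ` with `aₙ` homogeneous of degree `n`, written as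
power series `∑ aₙ Xⁿ` and multiplied as such. `DiagSeries True` is the algebra of power series of
diagrams modulo STU and 1T; `DiagSeries False` is its framed version, modulo STU only. -/
noncomputable def DiagSeries (oneT : Prop) : Subalgebra ℚ (PowerSeries (DiagAlg oneT)) where
  carrier := {f | ∀ n, PowerSeries.coeff n f ∈ DiagAlg.part oneT n}
  mul_mem' := by
    intro f g hf hg n
    rw [PowerSeries.coeff_mul]
    refine Submodule.sum_mem _ fun p hp => ?_
    rw [← Finset.HasAntidiagonal.mem_antidiagonal.1 hp]
    exact DiagAlg.mul_mem_part (hf _) (hg _)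
  add_mem' := by
    intro f g hf hg n
    rw [map_add]
    exact Submodule.add_mem _ (hf n) (hg n)
  algebraMap_mem' := by
    intro q n
    rw [Algebra.algebraMap_eq_smul_one, PowerSeries.coeff_smul, PowerSeries.coeff_one]
    split_ifs with h
    · subst h
      exact Submodule.smul_mem _ _ (DiagAlg.one_mem_part oneT)
    · rw [smul_zero]
      exact Submodule.zero_mem _

/-! ### Weight systems -/

section Weights

variable {K 𝔤 : Type*} [Field K] [LieRing 𝔤] [LieAlgebra K 𝔤] {d : ℕ}
  {B : LinearMap.BilinForm K 𝔤} (hB : B.Nondegenerate) (b : Module.Basis (Fin d) K 𝔤)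

/-- The names of the edges. -/
def edgeNames (legs : List HalfEdge) (verts : List TriVertex) : Finset ℕ :=
  ((allEnds legs verts).map Prod.fst).toFinset

open Classical in
/-- When the edges in `E` are coloured by basis indices, an edge of colour `i` carries the basis
vector `bᵢ` at its end `true` and the dual basis vector `bⁱ` at its end `false`. -/
noncomputable def endVector (E : Finset ℕ) (c : E → Fin d) (x : HalfEdge) : 𝔤 :=
  if h : x.1 ∈ E then
    (if x.2 = true then b (c ⟨x.1, h⟩) else B.dualBasis hB b (c ⟨x.1, h⟩))
  else 0

/-- The element of `U(𝔤)` of a diagram: each edge stands for the tensor `∑ bᵢ ⊗ bⁱ` inverse to the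
form, each trivalent vertex for the trilinear form `B ⁅x, y⁆ z`, and the vectors at the legs are
multiplied in `U(𝔤)` in the order of the legs. -/
noncomputable def diagramWeight (legs : List HalfEdge) (verts : List TriVertex) :
    UniversalEnvelopingAlgebra K 𝔤 :=
  let E := edgeNames legs verts
  ∑ c : E → Fin d,
    (verts.map fun v =>
      B ⁅endVector hB b E c v.1, endVector hB b E c v.2.1⁆ (endVector hB b E c v.2.2)).prod •
    (legs.map fun x => UniversalEnvelopingAlgebra.ι K (endVector hB b E c x)).prod

/-- The names of the chords, i.e. of the edges with both ends on the skeleton. -/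
def chordNames (legs : List HalfEdge) : Finset ℕ :=
  ((legs.map Prod.fst).toFinset).filter fun e => (e, true) ∈ legs ∧ (e, false) ∈ legs

/-- The deframed weight `∑ (-C)^|S| w(D ∖ S)`: the sum is over the sets `S` of chords of `D`, and
`C` is the weight of the diagram with a single chord, that is, the Casimir element. It is `w(D)`
when `D` has no chords. -/
noncomputable def deframedWeight (legs : List HalfEdge) (verts : List TriVertex) :
    UniversalEnvelopingAlgebra K 𝔤 :=
  ∑ S ∈ (chordNames legs).powerset,
    (-diagramWeight hB b [(0, true), (0, false)] []) ^ S.card *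
      diagramWeight hB b (legs.filter fun x => x.1 ∉ S) verts

end Weights

section Representation

variable {K 𝔤 : Type*} [Field K] [LieRing 𝔤] [LieAlgebra K 𝔤]
  (V : Type*) [AddCommGroup V] [Module K V] [LieRingModule 𝔤 V] [LieModule K 𝔤 V]

/-- The action of `U(𝔤)` on a representation of `𝔤`. -/
noncomputable def envelopingAction : UniversalEnvelopingAlgebra K 𝔤 →ₐ[K] Module.End K V :=
  UniversalEnvelopingAlgebra.lift K (LieModule.toEnd K 𝔤 V)

/-- The Lie algebra, the form and the representation are defined over `ℚ`: all structure constants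
are rational in suitable bases. -/
def DefinedOverRat [CharZero K] (B : LinearMap.BilinForm K 𝔤) : Prop :=
  ∃ (b : Module.Basis (Fin (Module.finrank K 𝔤)) K 𝔤)
    (v : Module.Basis (Fin (Module.finrank K V)) K V),
    (∀ i j k, b.repr ⁅b i, b j⁆ k ∈ (algebraMap ℚ K).range) ∧
    (∀ i j, B (b i) (b j) ∈ (algebraMap ℚ K).range) ∧
    (∀ i s t, v.repr ⁅b i, v s⁆ t ∈ (algebraMap ℚ K).range)

end Representation

/-! The weight of a diagram is a contraction: a monomial in vectors placed on the half-edges, summed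
over colourings that put the Casimir tensor on every edge. Three facts about this tensor suffice. It
is determined by `B` (`IsCasimirPair.sum_eq`), hence independent of bases and of the orientation of
edges; it is `𝔤`-invariant (`IsCasimirPair.sum_lie_add`); and, being symmetric, it is killed by the
bracket (`IsCasimirPair.sum_lie_eq_zero`).

Commuting with `z` acts on a monomial as a derivation, by `⁅z, ·⁆` at each half-edge, because the
vertex form is invariant. On a contracted edge the two terms cancel, so only free ends contribute
(`commutator_contract`). Without free ends the weight is central. With one edge cut open the same
formula compares the two positions of a base point, and the difference contains `∑ ⁅uᵢ, vᵢ⁆ = 0`.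
STU is the identity `∑ B(uᵢ, ⁅y, z⁆) vᵢ = ⁅y, z⁆` followed by `⁅y, z⁆ = yz - zy` in the enveloping
algebra.

An isolated chord contributes the central factor `C`. The alternating sum over sets of chords
therefore cancels in pairs on a diagram with an isolated chord, while the other relations survive
deframing (`IsDiagramWeight.deframed`).

Both weights thus define ring homomorphisms from the diagram algebra into the centre of `U(𝔤)`. By
Schur's lemma the centre acts on `V` through a character, and applying the composite coefficientwise
to power series gives `wρ` (`IsDiagramWeight.exists_hom`). For rational data the dual basis is
rational too, so weights act by rational matrices and the scalars, as diagonal entries, are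
rational. -/

/-! ### Contractions over edges -/

section Contraction

variable {K 𝔤 M : Type*} {d : ℕ}

/-- Put the vector `u s` on the end `s` of the edge `e`. -/
def setEdge (X : HalfEdge → 𝔤) (e : ℕ) (u : Bool → 𝔤) : HalfEdge → 𝔤 :=
  fun h => if h.1 = e then u h.2 else X h

/-- Put on the edges `e` of `E` the vectors of the family `p e` chosen by the colouring `c`. -/
def assign (p : ℕ → Bool → Fin d → 𝔤) (E : Finset ℕ) (c : E → Fin d) (X : HalfEdge → 𝔤) :
    HalfEdge → 𝔤 :=
  fun h => if hm : h.1 ∈ E then p h.1 h.2 (c ⟨h.1, hm⟩) else X h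

/-- The sum over the colourings of `E` of the values of `G`. -/
def contract [AddCommMonoid M] (p : ℕ → Bool → Fin d → 𝔤) (E : Finset ℕ)
    (G : (HalfEdge → 𝔤) → M) (X : HalfEdge → 𝔤) : M :=
  ∑ c : E → Fin d, G (assign p E c X)

theorem setEdge_of_eq (X : HalfEdge → 𝔤) {e : ℕ} (u : Bool → 𝔤) {h : HalfEdge} (hh : h.1 = e) :
    setEdge X e u h = u h.2 := if_pos hh

theorem setEdge_of_ne (X : HalfEdge → 𝔤) {e : ℕ} (u : Bool → 𝔤) {h : HalfEdge} (hh : h.1 ≠ e) :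
    setEdge X e u h = X h := if_neg hh

theorem assign_of_notMem (p : ℕ → Bool → Fin d → 𝔤) {E : Finset ℕ} (c : E → Fin d)
    (X : HalfEdge → 𝔤) {h : HalfEdge} (hh : h.1 ∉ E) : assign p E c X h = X h := dif_neg hh

/-- A colouring of `insert e E` is a colour of `e` and a colouring of `E`. -/
def colouringInsertEquiv {e : ℕ} {E : Finset ℕ} (he : e ∉ E) :
    (↥(insert e E) → Fin d) ≃ Fin d × (E → Fin d) where
  toFun c := (c ⟨e, Finset.mem_insert_self e E⟩, fun x => c ⟨x.1, Finset.mem_insert_of_mem x.2⟩)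
  invFun q x := if h : x.1 ∈ E then q.2 ⟨x.1, h⟩ else q.1
  left_inv c := by
    funext ⟨x, hx⟩
    by_cases h : x ∈ E
    · simp [h]
    · obtain rfl : x = e := by simpa [h] using hx
      simp [h]
  right_inv q := by
    refine Prod.ext ?_ (funext fun x => ?_)
    · simp [he]
    · simp

theorem assign_insert (p : ℕ → Bool → Fin d → 𝔤) {e : ℕ} {E : Finset ℕ} (he : e ∉ E)
    (q : Fin d × (E → Fin d)) (X : HalfEdge → 𝔤) :
    assign p (insert e E) ((colouringInsertEquiv he).symm q) X =
      setEdge (assign p E q.2 X) e (fun s => p e s q.1) := by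
  funext h
  by_cases h1 : h.1 = e
  · subst h1
    simp [assign, setEdge, colouringInsertEquiv, he]
  · by_cases h2 : h.1 ∈ E <;> simp [assign, setEdge, colouringInsertEquiv, h1, h2]

theorem setEdge_assign (p : ℕ → Bool → Fin d → 𝔤) {e : ℕ} {E : Finset ℕ} (he : e ∉ E)
    (c : E → Fin d) (X : HalfEdge → 𝔤) (u : Bool → 𝔤) :
    setEdge (assign p E c X) e u = assign p E c (setEdge X e u) := by
  funext h
  by_cases h1 : h.1 = e
  · subst h1
    simp [assign, setEdge, he]
  · by_cases h2 : h.1 ∈ E <;> simp [assign, setEdge, h1, h2]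

theorem assign_update (p : ℕ → Bool → Fin d → 𝔤) {E : Finset ℕ} (c : E → Fin d)
    (X : HalfEdge → 𝔤) {h : HalfEdge} (hh : h.1 ∉ E) (v : 𝔤) :
    assign p E c (Function.update X h v) = Function.update (assign p E c X) h v := by
  funext x
  by_cases hx : x = h
  · subst hx
    simp [assign, hh]
  · simp [assign, hx]

theorem setEdge_eq_update (X : HalfEdge → 𝔤) (e : ℕ) (u : Bool → 𝔤) :
    setEdge X e u = Function.update (Function.update X (e, true) (u true)) (e, false) (u false) := by
  funext ⟨n, s⟩
  by_cases h : n = e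
  · subst h
    cases s <;> simp [setEdge]
  · simp [setEdge, h]

/-- Both orders of updating are needed: linearity at an end of the edge can be read off only when
that end is updated last. -/
theorem setEdge_eq_update' (X : HalfEdge → 𝔤) (e : ℕ) (u : Bool → 𝔤) :
    setEdge X e u = Function.update (Function.update X (e, false) (u false)) (e, true) (u true) := by
  rw [setEdge_eq_update, Function.update_comm]
  simp

section AddCommMonoid

variable [AddCommMonoid M]

@[simp]
theorem contract_empty (p : ℕ → Bool → Fin d → 𝔤) (G : (HalfEdge → 𝔤) → M) (X : HalfEdge → 𝔤) :
    contract p ∅ G X = G X := by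
  rw [contract, Fintype.sum_unique]
  congr 1

/-- The edge `e` may be contracted before the edges of `E`. -/
theorem contract_insert (p : ℕ → Bool → Fin d → 𝔤) {e : ℕ} {E : Finset ℕ} (he : e ∉ E)
    (G : (HalfEdge → 𝔤) → M) (X : HalfEdge → 𝔤) :
    contract p (insert e E) G X =
      contract p E (fun Y => ∑ i, G (setEdge Y e fun s => p e s i)) X := by
  rw [contract, ← (colouringInsertEquiv he).symm.sum_comp, Fintype.sum_prod_type_right]
  simp only [assign_insert]
  rfl

/-- The edge `e` may be contracted after the edges of `E`. -/
theorem contract_insert' (p : ℕ → Bool → Fin d → 𝔤) {e : ℕ} {E : Finset ℕ} (he : e ∉ E)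
    (G : (HalfEdge → 𝔤) → M) (X : HalfEdge → 𝔤) :
    contract p (insert e E) G X =
      ∑ i, contract p E G (setEdge X e fun s => p e s i) := by
  rw [contract_insert p he]
  simp only [contract]
  rw [Finset.sum_comm]
  simp only [setEdge_assign p he]

theorem contract_union (p : ℕ → Bool → Fin d → 𝔤) {E F : Finset ℕ} (h : Disjoint E F)
    (G : (HalfEdge → 𝔤) → M) (X : HalfEdge → 𝔤) :
    contract p (E ∪ F) G X = contract p E (contract p F G) X := by
  induction E using Finset.induction_on generalizing X with
  | empty => simp
  | insert e E he ih =>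
    rw [Finset.disjoint_insert_left] at h
    rw [Finset.insert_union, contract_insert' p (by simp [he, h.1]), contract_insert' p he]
    exact Finset.sum_congr rfl fun i _ => ih h.2 _

theorem contract_congr (p : ℕ → Bool → Fin d → 𝔤) (E : Finset ℕ)
    {G G' : (HalfEdge → 𝔤) → M} (h : ∀ X, G X = G' X) (X : HalfEdge → 𝔤) :
    contract p E G X = contract p E G' X :=
  Finset.sum_congr rfl fun _ _ => h _

theorem contract_sum {ι : Type*} (p : ℕ → Bool → Fin d → 𝔤) (E : Finset ℕ) (s : Finset ι)
    (G : ι → (HalfEdge → 𝔤) → M) (X : HalfEdge → 𝔤) :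
    contract p E (fun Y => ∑ i ∈ s, G i Y) X = ∑ i ∈ s, contract p E (G i) X :=
  Finset.sum_comm

/-- `G` depends only on the vectors at the half-edges in `H`. -/
def DependsOnEnds (H : Set HalfEdge) (G : (HalfEdge → 𝔤) → M) : Prop :=
  ∀ X Y : HalfEdge → 𝔤, (∀ h ∈ H, X h = Y h) → G X = G Y

theorem DependsOnEnds.contract_congr {H : Set HalfEdge} {G : (HalfEdge → 𝔤) → M}
    (hG : DependsOnEnds H G) (p : ℕ → Bool → Fin d → 𝔤) (E : Finset ℕ) {X Y : HalfEdge → 𝔤}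
    (h : ∀ x ∈ H, x.1 ∉ E → X x = Y x) : contract p E G X = contract p E G Y := by
  refine Finset.sum_congr rfl fun c _ => hG _ _ fun x hx => ?_
  by_cases hE : x.1 ∈ E
  · simp [assign, hE]
  · simp [assign, hE, h x hx hE]

theorem setEdge_comp {f : HalfEdge → HalfEdge} {g : ℕ → ℕ} {t : ℕ → Bool → Bool}
    (hf : ∀ h, f h = (g h.1, t h.1 h.2)) (hg : Function.Injective g) (X : HalfEdge → 𝔤) (e : ℕ)
    (u : Bool → 𝔤) : setEdge X (g e) u ∘ f = setEdge (X ∘ f) e (u ∘ t e) := by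
  funext h
  by_cases h1 : h.1 = e
  · subst h1
    simp [setEdge, hf]
  · simp [setEdge, hf, h1, hg.ne h1]

/-- Renaming the half-edges in a contraction. -/
theorem contract_comp {f : HalfEdge → HalfEdge} {g : ℕ → ℕ} {t : ℕ → Bool → Bool}
    (hf : ∀ h, f h = (g h.1, t h.1 h.2)) (hg : Function.Injective g)
    (p : ℕ → Bool → Fin d → 𝔤) (E : Finset ℕ) (G : (HalfEdge → 𝔤) → M) (X : HalfEdge → 𝔤) :
    contract p (E.image g) (fun Y => G (Y ∘ f)) X =
      contract (fun e s => p (g e) (t e s)) E G (X ∘ f) := by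
  induction E using Finset.induction_on generalizing X with
  | empty => simp
  | insert e E he ih =>
    have he' : g e ∉ E.image g := by simpa [hg.eq_iff] using he
    rw [Finset.image_insert, contract_insert' _ he', contract_insert' _ he]
    refine Finset.sum_congr rfl fun i _ => ?_
    rw [ih, setEdge_comp hf hg]
    rfl

end AddCommMonoid

theorem contract_mul {A : Type*} [NonUnitalNonAssocSemiring A] (p : ℕ → Bool → Fin d → 𝔤)
    {E F : Finset ℕ} (hEF : Disjoint E F) {H H' : Set HalfEdge} {G G' : (HalfEdge → 𝔤) → A}
    (hG : DependsOnEnds H G) (hG' : DependsOnEnds H' G') (hH : ∀ h ∈ H, h.1 ∈ E)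
    (hH' : ∀ h ∈ H', h.1 ∈ F) (X : HalfEdge → 𝔤) :
    contract p (E ∪ F) (fun Y => G Y * G' Y) X = contract p E G X * contract p F G' X := by
  rw [contract_union p hEF]
  -- Colouring `F` does not touch the ends seen by `G`; once `F` is contracted, `G'` no longer sees
  -- the background, so `Y` may be replaced by `X`.
  have h1 : ∀ Y, contract p F (fun Z => G Z * G' Z) Y = G Y * contract p F G' X := by
    intro Y
    rw [hG'.contract_congr p F (X := X) (Y := Y) fun x hx hx' => absurd (hH' x hx) hx']
    simp only [contract, Finset.mul_sum]
    refine Finset.sum_congr rfl fun c _ => ?_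
    congr 1
    exact hG _ _ fun h hh => assign_of_notMem p c Y (Finset.disjoint_left.1 hEF (hH h hh))
  rw [contract_congr p E h1]
  exact (Finset.sum_mul _ _ _).symm

end Contraction

/-! ### Casimir pairs -/

section Casimir

variable {K 𝔤 M : Type*} [Field K] [LieRing 𝔤] [LieAlgebra K 𝔤] {d : ℕ}

/-- Two families `u`, `v` such that `∑ uᵢ ⊗ vᵢ` is the symmetric tensor inverse to `B`. -/
def IsCasimirPair (B : LinearMap.BilinForm K 𝔤) (u v : Fin d → 𝔤) : Prop :=
  (∀ x, ∑ i, B (u i) x • v i = x) ∧ ∀ x, ∑ i, B (v i) x • u i = x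

theorem IsCasimirPair.swap {B : LinearMap.BilinForm K 𝔤} {u v : Fin d → 𝔤}
    (h : IsCasimirPair B u v) : IsCasimirPair B v u := ⟨h.2, h.1⟩

theorem isCasimirPair_dualBasis {B : LinearMap.BilinForm K 𝔤} (hB : B.Nondegenerate)
    (hsymm : B.IsSymm) (b : Module.Basis (Fin d) K 𝔤) : IsCasimirPair B b (B.dualBasis hB b) := by
  have h : ∀ x, ∑ i, B (b i) x • B.dualBasis hB b i = x := fun x => by
    conv_rhs => rw [← (B.dualBasis hB b).sum_repr x]
    simp only [LinearMap.BilinForm.dualBasis_repr_apply]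
    exact Finset.sum_congr rfl fun i _ => by rw [hsymm.eq]
  have h' : ∀ x, ∑ i, B (B.dualBasis hB b i) x • b i = x := fun x => by
    conv_rhs => rw [← b.sum_repr x]
    refine Finset.sum_congr rfl fun i _ => ?_
    congr 1
    conv_lhs => rw [← b.sum_repr x]
    rw [map_sum]
    simp only [map_smul, LinearMap.BilinForm.apply_dualBasis_left]
    simp
  exact ⟨h, h'⟩

variable [AddCommGroup M] [Module K M]

/-- Uniqueness of the tensor inverse to `B`, tested on bilinear maps: expand `vᵢ` through the second
pair, exchange the sums, and recognise the expansion of `u'ⱼ` through the first. -/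
theorem IsCasimirPair.sum_eq {B : LinearMap.BilinForm K 𝔤} (hsymm : B.IsSymm)
    {u v u' v' : Fin d → 𝔤} (h : IsCasimirPair B u v) (h' : IsCasimirPair B u' v')
    (β : 𝔤 →ₗ[K] 𝔤 →ₗ[K] M) : ∑ i, β (u i) (v i) = ∑ i, β (u' i) (v' i) := by
  calc ∑ i, β (u i) (v i) = ∑ i, ∑ j, B (u' j) (v i) • β (u i) (v' j) := by
        refine Finset.sum_congr rfl fun i _ => ?_
        conv_lhs => rw [← h'.1 (v i)]
        simp
    _ = ∑ j, ∑ i, B (u' j) (v i) • β (u i) (v' j) := Finset.sum_comm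
    _ = ∑ j, β (u' j) (v' j) := by
        refine Finset.sum_congr rfl fun j _ => ?_
        conv_rhs => rw [← h.2 (u' j)]
        simp only [map_sum, map_smul, LinearMap.sum_apply, LinearMap.smul_apply, hsymm.eq (u' j)]

/-- Invariance of the Casimir tensor: expanding both brackets through the pair gives coefficients of
`β (uᵢ) (vⱼ)` that are opposite by invariance of `B`. -/
theorem IsCasimirPair.sum_lie_add {B : LinearMap.BilinForm K 𝔤} (hsymm : B.IsSymm)
    (hinv : B.lieInvariant 𝔤) {u v : Fin d → 𝔤} (h : IsCasimirPair B u v)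
    (β : 𝔤 →ₗ[K] 𝔤 →ₗ[K] M) (z : 𝔤) : ∑ i, (β ⁅z, u i⁆ (v i) + β (u i) ⁅z, v i⁆) = 0 := by
  have h1 : ∑ i, β ⁅z, u i⁆ (v i) = ∑ i, ∑ j, B (v j) ⁅z, u i⁆ • β (u j) (v i) := by
    refine Finset.sum_congr rfl fun i _ => ?_
    conv_lhs => rw [← h.2 ⁅z, u i⁆]
    simp
  have h2 : ∑ i, β (u i) ⁅z, v i⁆ = ∑ i, ∑ j, B (u j) ⁅z, v i⁆ • β (u i) (v j) := by
    refine Finset.sum_congr rfl fun i _ => ?_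
    conv_lhs => rw [← h.1 ⁅z, v i⁆]
    simp
  rw [Finset.sum_add_distrib, h1, h2, Finset.sum_comm, ← Finset.sum_add_distrib]
  refine Finset.sum_eq_zero fun i _ => ?_
  rw [← Finset.sum_add_distrib]
  refine Finset.sum_eq_zero fun j _ => ?_
  rw [← add_smul, hsymm.eq (v i), hinv, hsymm.eq (u j), neg_add_cancel, zero_smul]

/-- The swapped pair represents the same tensor, so the sum equals its own negative. This is what
makes the base point irrelevant. -/
theorem IsCasimirPair.sum_lie_eq_zero [CharZero K] {B : LinearMap.BilinForm K 𝔤}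
    (hsymm : B.IsSymm) {u v : Fin d → 𝔤} (h : IsCasimirPair B u v) : ∑ i, ⁅u i, v i⁆ = 0 := by
  have h1 := h.sum_eq hsymm h.swap (LieModule.toEnd K 𝔤 𝔤 : 𝔤 →ₗ[K] 𝔤 →ₗ[K] 𝔤)
  have h2 : ∑ i, ⁅u i, v i⁆ = -∑ i, ⁅u i, v i⁆ := by
    rw [← Finset.sum_neg_distrib]
    simpa using h1
  have h3 : (2 : K) • ∑ i, ⁅u i, v i⁆ = 0 := by
    rw [two_smul]
    nth_rewrite 1 [h2]
    exact neg_add_cancel _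
  exact (smul_eq_zero.1 h3).resolve_left two_ne_zero

end Casimir

/-! ### Linearity and invariance of contractions -/

section Linearity

variable {K 𝔤 M : Type*} [Field K] [LieRing 𝔤] [LieAlgebra K 𝔤] {d : ℕ} [AddCommGroup M]
  [Module K M]

variable (K) in
/-- `G` is linear in the vector at the half-edge `h`. -/
def LinearAt (G : (HalfEdge → 𝔤) → M) (h : HalfEdge) : Prop :=
  ∀ X, IsLinearMap K fun v => G (Function.update X h v)

theorem LinearAt.contract {G : (HalfEdge → 𝔤) → M} {h : HalfEdge} (hG : LinearAt K G h)
    (p : ℕ → Bool → Fin d → 𝔤) {E : Finset ℕ} (hh : h.1 ∉ E) : LinearAt K (contract p E G) h := by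
  intro X
  constructor
  · intro v w
    simp only [_root_.contract, assign_update _ _ _ hh, (hG _).map_add, Finset.sum_add_distrib]
  · intro a v
    simp only [_root_.contract, assign_update _ _ _ hh, (hG _).map_smul, Finset.smul_sum]

theorem exists_bilinear_setEdge {G : (HalfEdge → 𝔤) → M} {e : ℕ}
    (hG : ∀ s, LinearAt K G (e, s)) (X : HalfEdge → 𝔤) :
    ∃ β : 𝔤 →ₗ[K] 𝔤 →ₗ[K] M, ∀ u, G (setEdge X e u) = β (u true) (u false) := by
  refine ⟨LinearMap.mk₂ K (fun v w => G (setEdge X e fun s => if s then v else w)) ?_ ?_ ?_ ?_, ?_⟩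
  · intro v v' w
    simp only [setEdge_eq_update', if_true, (hG true _).map_add]
    simp
  · intro a v w
    simp only [setEdge_eq_update', if_true, (hG true _).map_smul]
    simp
  · intro v w w'
    simp only [setEdge_eq_update, Bool.false_eq_true, if_false, (hG false _).map_add]
    simp
  · intro a v w
    simp only [setEdge_eq_update, Bool.false_eq_true, if_false, (hG false _).map_smul]
    simp
  · intro u
    simp only [LinearMap.mk₂_apply]
    congr 2
    funext s
    cases s <;> rfl

/-- A contraction does not depend on the presentation of the Casimir tensor on the edges. -/
theorem contract_eq_of_isCasimirPair {B : LinearMap.BilinForm K 𝔤} (hsymm : B.IsSymm)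
    {p p' : ℕ → Bool → Fin d → 𝔤} {E : Finset ℕ} {G : (HalfEdge → 𝔤) → M}
    (hp : ∀ e, IsCasimirPair B (p e true) (p e false))
    (hp' : ∀ e, IsCasimirPair B (p' e true) (p' e false))
    (hG : ∀ h : HalfEdge, h.1 ∈ E → LinearAt K G h) (X : HalfEdge → 𝔤) :
    contract p E G X = contract p' E G X := by
  induction E using Finset.induction_on generalizing X with
  | empty => simp
  | insert e E he ih =>
    rw [contract_insert' _ he, contract_insert' _ he]
    obtain ⟨β, hβ⟩ := exists_bilinear_setEdge
      (fun s => (hG (e, s) (Finset.mem_insert_self e E)).contract p' he) X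
    -- The edges of `E` now carry `p'` on both sides; only the pair at `e` differs, and it enters
    -- through the bilinear map `β`.
    simp only [ih fun h hh => hG h (Finset.mem_insert_of_mem hh), hβ]
    exact (hp e).sum_eq hsymm (hp' e) β

/-- The action of `z` on the two ends of a contracted edge cancels. -/
theorem contract_lie_edge {B : LinearMap.BilinForm K 𝔤} (hsymm : B.IsSymm)
    (hinv : B.lieInvariant 𝔤) {p : ℕ → Bool → Fin d → 𝔤} {E : Finset ℕ} {e : ℕ} (he : e ∈ E)
    (hp : IsCasimirPair B (p e true) (p e false)) {G : (HalfEdge → 𝔤) → M}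
    (hG : ∀ s, LinearAt K G (e, s)) (z : 𝔤) (X : HalfEdge → 𝔤) :
    contract p E (fun Y => ∑ s, G (Function.update Y (e, s) ⁅z, Y (e, s)⁆)) X = 0 := by
  rw [← Finset.insert_erase he, contract_insert _ (Finset.notMem_erase e E)]
  -- The cancellation takes place at the edge `e` alone, for each fixed colouring of the other
  -- edges.
  refine Finset.sum_eq_zero fun c _ => ?_
  generalize assign p (E.erase e) c X = Y
  obtain ⟨β, hβ⟩ := exists_bilinear_setEdge hG Y
  rw [← hp.sum_lie_add hsymm hinv β z]
  refine Finset.sum_congr rfl fun i _ => ?_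
  have key : ∀ s, Function.update (setEdge Y e fun s => p e s i) (e, s)
      ⁅z, (setEdge Y e fun s => p e s i) (e, s)⁆ =
        setEdge Y e (Function.update (fun s => p e s i) s ⁅z, p e s i⁆) := by
    intro s
    funext ⟨n, t⟩
    by_cases hn : n = e
    · subst hn
      by_cases ht : t = s
      · subst ht
        simp [setEdge]
      · simp [setEdge, ht]
    · simp [setEdge, hn]
  simp only [key, hβ, Fintype.sum_bool]
  simp

end Linearity

/-! ### Products over lists of local contributions -/

section ListProduct

variable {𝔤 A τ : Type*} [Ring A] {ends : τ → List HalfEdge} {φ : τ → (HalfEdge → 𝔤) → A}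

theorem prod_map_update (hφ : ∀ t h X v, h ∉ ends t → φ t (Function.update X h v) = φ t X)
    {l : List τ} {h : HalfEdge} (hh : h ∉ l.flatMap ends) (X : HalfEdge → 𝔤) (v : 𝔤) :
    (l.map fun t => φ t (Function.update X h v)).prod = (l.map fun t => φ t X).prod := by
  congr 1
  refine List.map_congr_left fun t ht => hφ t h X v fun h' => hh ?_
  exact List.mem_flatMap.2 ⟨t, ht, h'⟩

variable {K : Type*} [Field K] [LieRing 𝔤] [LieAlgebra K 𝔤] [Algebra K A]

theorem linearAt_prod (hφ : ∀ t h X v, h ∉ ends t → φ t (Function.update X h v) = φ t X)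
    (hlin : ∀ t, (ends t).Nodup → ∀ h ∈ ends t, LinearAt K (φ t) h) {l : List τ}
    (hl : (l.flatMap ends).Nodup) {h : HalfEdge} (hh : h ∈ l.flatMap ends) :
    LinearAt K (fun X => (l.map fun t => φ t X).prod) h := by
  induction l with
  | nil => simp at hh
  | cons t l ih =>
    rw [List.flatMap_cons, List.nodup_append'] at hl
    rw [List.flatMap_cons, List.mem_append] at hh
    intro X
    simp only [List.map_cons, List.prod_cons]
    rcases hh with hh | hh
    · simp only [prod_map_update hφ (hl.2.2 hh)]
      have h1 := hlin t hl.1 h hh X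
      exact ⟨fun v w => by rw [h1.map_add, add_mul],
        fun a v => by rw [h1.map_smul, smul_mul_assoc]⟩
    · simp only [hφ t h X _ fun h' => hl.2.2 h' hh]
      have h1 : IsLinearMap K fun v => (l.map fun t => φ t (Function.update X h v)).prod :=
        ih hl.2.1 hh X
      exact ⟨fun v w => by rw [h1.map_add, mul_add],
        fun a v => by rw [h1.map_smul, mul_smul_comm]⟩

/-- The Leibniz rule for `[a, ·]`: each half-edge belongs to exactly one factor, so changing its
vector changes that factor only. -/
theorem commutator_prod (hφ : ∀ t h X v, h ∉ ends t → φ t (Function.update X h v) = φ t X)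
    (a : A) (z : 𝔤) (hD : ∀ t, (ends t).Nodup → ∀ X, a * φ t X - φ t X * a =
      ((ends t).map fun h => φ t (Function.update X h ⁅z, X h⁆)).sum) {l : List τ}
    (hl : (l.flatMap ends).Nodup) (X : HalfEdge → 𝔤) :
    a * (l.map fun t => φ t X).prod - (l.map fun t => φ t X).prod * a =
      ((l.flatMap ends).map fun h =>
        (l.map fun t => φ t (Function.update X h ⁅z, X h⁆)).prod).sum := by
  induction l with
  | nil => simp
  | cons t l ih =>
    rw [List.flatMap_cons, List.nodup_append'] at hl
    simp only [List.map_cons, List.prod_cons, List.flatMap_cons, List.map_append, List.sum_append]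
    have h1 : ((ends t).map fun h => φ t (Function.update X h ⁅z, X h⁆) *
        (l.map fun t => φ t (Function.update X h ⁅z, X h⁆)).prod) =
        ((ends t).map fun h => φ t (Function.update X h ⁅z, X h⁆) *
          (l.map fun t => φ t X).prod) :=
      List.map_congr_left fun h hh => by rw [prod_map_update hφ (hl.2.2 hh)]
    have h2 : ((l.flatMap ends).map fun h => φ t (Function.update X h ⁅z, X h⁆) *
        (l.map fun t => φ t (Function.update X h ⁅z, X h⁆)).prod) =
        ((l.flatMap ends).map fun h => φ t X *
          (l.map fun t => φ t (Function.update X h ⁅z, X h⁆)).prod) :=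
      List.map_congr_left fun h hh => by rw [hφ t h X _ fun h' => hl.2.2 h' hh]
    rw [h1, h2, List.sum_map_mul_right, List.sum_map_mul_left, ← ih hl.2.1, ← hD t hl.1]
    noncomm_ring

end ListProduct

/-! ### Monomials of diagrams -/

section Monomial

variable {K 𝔤 A : Type*} [Field K] [LieRing 𝔤] [LieAlgebra K 𝔤] [Ring A] [Algebra K A]
  {d : ℕ} (B : LinearMap.BilinForm K 𝔤) (j : 𝔤 →ₗ[K] A)

/-- The value of the trilinear form at a vertex. -/
def vertexForm (X : HalfEdge → 𝔤) (v : TriVertex) : K := B ⁅X v.1, X v.2.1⁆ (X v.2.2)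

/-- The contribution of a diagram whose half-edges carry given vectors. -/
def monomial (legs : List HalfEdge) (verts : List TriVertex) (X : HalfEdge → 𝔤) : A :=
  (verts.map (vertexForm B X)).prod • (legs.map fun x => j (X x)).prod

/-- The half-edges at a univalent or trivalent vertex. -/
def siteEnds : HalfEdge ⊕ TriVertex → List HalfEdge := Sum.elim (fun x => [x]) TriVertex.ends

/-- The contribution of a univalent or trivalent vertex. -/
def siteValue : HalfEdge ⊕ TriVertex → (HalfEdge → 𝔤) → A :=
  Sum.elim (fun x X => j (X x)) fun v X => algebraMap K A (vertexForm B X v)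

/-- Viewing the vertex scalars as elements of `A` puts legs and vertices on the same footing, so
that the lemmas on products of local factors apply to both. -/
theorem monomial_eq_prod (legs : List HalfEdge) (verts : List TriVertex) (X : HalfEdge → 𝔤) :
    monomial B j legs verts X =
      ((legs.map Sum.inl ++ verts.map Sum.inr).map fun t => siteValue B j t X).prod := by
  have h : ∀ vs : List TriVertex, (vs.map fun v => algebraMap K A (vertexForm B X v)).prod =
      algebraMap K A (vs.map (vertexForm B X)).prod := fun vs => by
    rw [map_list_prod, List.map_map]
    rfl
  simp only [List.map_append, List.map_map, List.prod_append, siteValue, Function.comp_def,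
    Sum.elim_inl, Sum.elim_inr, h, monomial]
  rw [Algebra.smul_def, Algebra.commutes]

theorem flatMap_siteEnds (legs : List HalfEdge) (verts : List TriVertex) :
    (legs.map Sum.inl ++ verts.map Sum.inr).flatMap siteEnds = allEnds legs verts := by
  simp [List.flatMap_append, List.flatMap_map, siteEnds, allEnds]

theorem siteValue_update (t : HalfEdge ⊕ TriVertex) (h : HalfEdge) (X : HalfEdge → 𝔤) (v : 𝔤)
    (hh : h ∉ siteEnds t) : siteValue B j t (Function.update X h v) = siteValue B j t X := by
  rcases t with x | ⟨a, b, c⟩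
  · have : x ≠ h := fun e => hh (by simp [siteEnds, e])
    simp [siteValue, this]
  · simp only [siteEnds, Sum.elim_inr, TriVertex.ends, List.mem_cons, List.not_mem_nil, or_false,
      not_or] at hh
    simp [siteValue, vertexForm, Ne.symm hh.1, Ne.symm hh.2.1, Ne.symm hh.2.2]

theorem linearAt_siteValue (t : HalfEdge ⊕ TriVertex) (ht : (siteEnds t).Nodup) (h : HalfEdge)
    (hh : h ∈ siteEnds t) : LinearAt K (siteValue B j t) h := by
  intro X
  rcases t with x | ⟨a, b, c⟩
  · obtain rfl : h = x := by simpa [siteEnds] using hh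
    simp only [siteValue, Sum.elim_inl, Function.update_self]
    exact ⟨fun v w => map_add j v w, fun a v => map_smul j a v⟩
  · simp only [siteEnds, Sum.elim_inr, TriVertex.ends, List.nodup_cons, List.mem_cons,
      List.not_mem_nil, or_false, not_or] at ht hh
    obtain ⟨⟨hab, hac⟩, hbc, -⟩ := ht
    simp only [siteValue, Sum.elim_inr, vertexForm]
    rcases hh with rfl | rfl | rfl
    · simp only [Function.update_self, Function.update_of_ne (Ne.symm hab),
        Function.update_of_ne (Ne.symm hac)]
      exact ⟨fun v w => by simp, fun a v => by simp [Algebra.smul_def]⟩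
    · simp only [Function.update_self, Function.update_of_ne hab,
        Function.update_of_ne (Ne.symm hbc)]
      exact ⟨fun v w => by simp, fun a v => by simp [Algebra.smul_def]⟩
    · simp only [Function.update_self, Function.update_of_ne hac, Function.update_of_ne hbc]
      exact ⟨fun v w => by simp, fun a v => by simp [Algebra.smul_def]⟩

variable {B j}

/-- At a leg this is the defining relation of the enveloping algebra. At a vertex the commutator
with a scalar vanishes, and the sum on the right vanishes because the trilinear form is invariant.
-/
theorem commutator_siteValue (hj : ∀ x y, j ⁅x, y⁆ = j x * j y - j y * j x)
    (hinv : B.lieInvariant 𝔤) (z : 𝔤) (t : HalfEdge ⊕ TriVertex) (ht : (siteEnds t).Nodup)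
    (X : HalfEdge → 𝔤) : j z * siteValue B j t X - siteValue B j t X * j z =
      ((siteEnds t).map fun h => siteValue B j t (Function.update X h ⁅z, X h⁆)).sum := by
  rcases t with x | ⟨a, b, c⟩
  · simp [siteValue, siteEnds, hj]
  · simp only [siteEnds, Sum.elim_inr, TriVertex.ends, List.nodup_cons, List.mem_cons,
      List.not_mem_nil, or_false, not_or] at ht
    obtain ⟨⟨hab, hac⟩, hbc, -⟩ := ht
    simp only [siteEnds, siteValue, Sum.elim_inr, TriVertex.ends, vertexForm, List.map_cons,
      List.map_nil, List.sum_cons, List.sum_nil, Function.update_self,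
      Function.update_of_ne hab, Function.update_of_ne hac, Function.update_of_ne hbc,
      Function.update_of_ne (Ne.symm hab), Function.update_of_ne (Ne.symm hac),
      Function.update_of_ne (Ne.symm hbc)]
    rw [← Algebra.commutes, sub_self, add_zero, ← map_add, ← map_add]
    symm
    convert map_zero (algebraMap K A)
    -- The Jacobi identity merges the first two terms into `B ⁅z, ⁅x, y⁆⁆ w`, which invariance
    -- cancels against `B ⁅x, y⁆ ⁅z, w⁆`.
    rw [← add_assoc, ← LinearMap.add_apply, ← map_add, ← leibniz_lie, hinv, neg_add_cancel]

theorem linearAt_monomial {legs : List HalfEdge} {verts : List TriVertex}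
    (hn : (allEnds legs verts).Nodup) {h : HalfEdge} (hh : h ∈ allEnds legs verts) :
    LinearAt K (monomial B j legs verts) h := by
  rw [funext (monomial_eq_prod B j legs verts)]
  rw [← flatMap_siteEnds] at hn hh
  exact linearAt_prod (siteValue_update B j) (linearAt_siteValue B j) hn hh

theorem commutator_monomial (hj : ∀ x y, j ⁅x, y⁆ = j x * j y - j y * j x)
    (hinv : B.lieInvariant 𝔤) {legs : List HalfEdge} {verts : List TriVertex}
    (hn : (allEnds legs verts).Nodup) (z : 𝔤) (X : HalfEdge → 𝔤) :
    j z * monomial B j legs verts X - monomial B j legs verts X * j z =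
      ∑ h ∈ (allEnds legs verts).toFinset,
        monomial B j legs verts (Function.update X h ⁅z, X h⁆) := by
  rw [List.sum_toFinset _ hn]
  simp only [monomial_eq_prod]
  rw [← flatMap_siteEnds] at hn ⊢
  exact commutator_prod (siteValue_update B j) (j z) z (commutator_siteValue hj hinv z) hn X

theorem dependsOnEnds_monomial (legs : List HalfEdge) (verts : List TriVertex) :
    DependsOnEnds {h | h ∈ allEnds legs verts} (monomial B j legs verts) := by
  intro X Y h
  have h1 : ∀ x ∈ legs, j (X x) = j (Y x) := fun x hx =>
    congrArg j (h x (List.mem_append_left _ hx))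
  have h2 : ∀ v ∈ verts, vertexForm B X v = vertexForm B Y v := by
    intro v hv
    have h3 : ∀ x ∈ v.ends, X x = Y x := fun x hx =>
      h x (List.mem_append_right _ (List.mem_flatMap.2 ⟨v, hv, hx⟩))
    simp only [vertexForm, h3 v.1 (by simp [TriVertex.ends]),
      h3 v.2.1 (by simp [TriVertex.ends]), h3 v.2.2 (by simp [TriVertex.ends])]
  rw [monomial, monomial, List.map_congr_left h1, List.map_congr_left h2]

/-- The action of `z` on a contraction is its action on the free ends. -/
theorem commutator_contract (hj : ∀ x y, j ⁅x, y⁆ = j x * j y - j y * j x)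
    (hsymm : B.IsSymm) (hinv : B.lieInvariant 𝔤) {legs : List HalfEdge} {verts : List TriVertex}
    (hn : (allEnds legs verts).Nodup) {p : ℕ → Bool → Fin d → 𝔤}
    (hp : ∀ e, IsCasimirPair B (p e true) (p e false)) {E : Finset ℕ}
    (hE : ∀ h : HalfEdge, h.1 ∈ E → h ∈ allEnds legs verts) (z : 𝔤) (X : HalfEdge → 𝔤) :
    j z * contract p E (monomial B j legs verts) X -
        contract p E (monomial B j legs verts) X * j z =
      ∑ h ∈ (allEnds legs verts).toFinset with h.1 ∉ E,
        contract p E (monomial B j legs verts) (Function.update X h ⁅z, X h⁆) := by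
  have h1 : (allEnds legs verts).toFinset.filter (fun h => h.1 ∈ E) = E ×ˢ Finset.univ := by
    ext h
    simp only [Finset.mem_filter, List.mem_toFinset, Finset.mem_product, Finset.mem_univ, and_true]
    exact ⟨fun h' => h'.2, fun h' => ⟨hE h h', h'⟩⟩
  have h2 : j z * contract p E (monomial B j legs verts) X -
        contract p E (monomial B j legs verts) X * j z =
      contract p E (fun Y => ∑ h ∈ (allEnds legs verts).toFinset,
        monomial B j legs verts (Function.update Y h ⁅z, Y h⁆)) X := by
    rw [← contract_congr p E fun Y => commutator_monomial hj hinv hn z Y]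
    simp only [contract, Finset.mul_sum, Finset.sum_mul, Finset.sum_sub_distrib]
  rw [h2, contract_sum, ← Finset.sum_filter_add_sum_filter_not _ (fun h : HalfEdge => h.1 ∈ E),
    h1, Finset.sum_product]
  have h3 : ∀ e ∈ E, ∑ s, contract p E (fun Y => monomial B j legs verts
      (Function.update Y (e, s) ⁅z, Y (e, s)⁆)) X = 0 := by
    intro e he
    rw [← contract_sum]
    exact contract_lie_edge hsymm hinv he (hp e) (fun s => linearAt_monomial hn (hE _ he)) z X
  rw [Finset.sum_congr rfl h3, Finset.sum_const_zero, zero_add]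
  -- What remains are ends outside `E`: colourings leave them alone, so the update may be made
  -- before the contraction.
  refine Finset.sum_congr rfl fun h hh => Finset.sum_congr rfl fun c _ => ?_
  have hh' := (Finset.mem_filter.1 hh).2
  simp only [assign_update _ _ _ hh', assign_of_notMem _ _ _ hh']

end Monomial

/-! ### The weight of a closed diagram -/

/-- Every half-edge ends at one place only, and every edge has both its ends in the diagram. -/
def IsClosedDiagram (legs : List HalfEdge) (verts : List TriVertex) : Prop :=
  (allEnds legs verts).Nodup ∧ ∀ x ∈ allEnds legs verts, x.opp ∈ allEnds legs verts

theorem isClosedDiagram_chord : IsClosedDiagram [(0, true), (0, false)] [] := by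
  refine ⟨by decide, ?_⟩
  intro x hx
  simp only [allEnds, List.flatMap_nil, List.append_nil, List.mem_cons, List.not_mem_nil,
    or_false] at hx ⊢
  rcases hx with rfl | rfl
  · exact Or.inr rfl
  · exact Or.inl rfl

/-- Connectedness is dropped here: none of the properties of the weight depends on it. -/
theorem UTDiagram.isClosedDiagram (D : UTDiagram) : IsClosedDiagram D.legs D.verts :=
  ⟨D.nodup, D.closed⟩

theorem HalfEdge.eq_or_eq_opp {x y : HalfEdge} (h : x.1 = y.1) : x = y ∨ x = y.opp := by
  obtain ⟨e, s⟩ := x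
  obtain ⟨e', s'⟩ := y
  obtain rfl : e = e' := h
  cases s <;> cases s' <;> simp [HalfEdge.opp]

@[simp]
theorem HalfEdge.opp_fst (x : HalfEdge) : x.opp.1 = x.1 := rfl

theorem HalfEdge.opp_ne (x : HalfEdge) : x.opp ≠ x := fun h => by
  simpa [HalfEdge.opp] using congrArg Prod.snd h

theorem mem_edgeNames {legs : List HalfEdge} {verts : List TriVertex} {e : ℕ} :
    e ∈ edgeNames legs verts ↔ ∃ x ∈ allEnds legs verts, x.1 = e := by
  simp only [edgeNames, List.mem_toFinset, List.mem_map]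

theorem fst_mem_edgeNames {legs : List HalfEdge} {verts : List TriVertex} {x : HalfEdge}
    (hx : x ∈ allEnds legs verts) : x.1 ∈ edgeNames legs verts :=
  mem_edgeNames.2 ⟨x, hx, rfl⟩

theorem IsClosedDiagram.mem_of_fst_mem {legs : List HalfEdge} {verts : List TriVertex}
    (h : IsClosedDiagram legs verts) {x : HalfEdge} (hx : x.1 ∈ edgeNames legs verts) :
    x ∈ allEnds legs verts := by
  obtain ⟨y, hy, hyx⟩ := mem_edgeNames.1 hx
  rcases HalfEdge.eq_or_eq_opp hyx.symm with rfl | rfl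
  · exact hy
  · exact h.2 _ hy

theorem mem_allEnds_left {legs : List HalfEdge} {verts : List TriVertex} {x : HalfEdge}
    (hx : x ∈ legs) : x ∈ allEnds legs verts := List.mem_append_left _ hx

theorem mem_allEnds_right {legs : List HalfEdge} {verts : List TriVertex} {v : TriVertex}
    {x : HalfEdge} (hv : v ∈ verts) (hx : x ∈ v.ends) : x ∈ allEnds legs verts :=
  List.mem_append_right _ (List.mem_flatMap.2 ⟨v, hv, hx⟩)

theorem rename_fst {f : HalfEdge → HalfEdge} (ho : ∀ x : HalfEdge, f x.opp = (f x).opp) (e : ℕ) (s : Bool) : (f (e, s)).1 = (f (e, true)).1 := by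
  cases s
  · have := ho (e, true)
    simp only [HalfEdge.opp, Bool.not_true] at this
    rw [this]
  · rfl

theorem rename_fst_injective {f : HalfEdge → HalfEdge} (hf : Function.Injective f)
    (ho : ∀ x : HalfEdge, f x.opp = (f x).opp) : Function.Injective fun e => (f (e, true)).1 := by
  intro e e' h
  rcases HalfEdge.eq_or_eq_opp h with h | h
  · exact congrArg Prod.fst (hf h)
  · rw [← ho] at h
    exact congrArg Prod.fst (hf h)

theorem allEnds_perm_of_forall₂_cycEq {l : List HalfEdge} {vs ws : List TriVertex}
    (h : List.Forall₂ TriVertex.CycEq vs ws) : (allEnds l vs).Perm (allEnds l ws) := by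
  refine List.Perm.append_left l ?_
  induction h with
  | nil => exact List.Perm.refl _
  | @cons v w vs ws hvw _ ih =>
    refine List.Perm.append ?_ ih
    obtain ⟨a, b, c⟩ := v
    rcases hvw with rfl | rfl | rfl
    · exact List.Perm.refl _
    · exact (List.perm_append_comm (l₁ := [a]) (l₂ := [b, c]))
    · exact (List.perm_append_comm (l₁ := [a, b]) (l₂ := [c]))

section ClosedWeight

variable {K 𝔤 A : Type*} [Field K] [LieRing 𝔤] [LieAlgebra K 𝔤] [Ring A] [Algebra K A]
  {d : ℕ} (B : LinearMap.BilinForm K 𝔤) (j : 𝔤 →ₗ[K] A) (p : ℕ → Bool → Fin d → 𝔤)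

/-- The contraction of the monomial of a diagram over all its edges. -/
def closedWeight (legs : List HalfEdge) (verts : List TriVertex) : A :=
  contract p (edgeNames legs verts) (monomial B j legs verts) 0

variable {B j p}

theorem IsClosedDiagram.linearAt {legs : List HalfEdge} {verts : List TriVertex}
    (hD : IsClosedDiagram legs verts) {h : HalfEdge} (hh : h.1 ∈ edgeNames legs verts) :
    LinearAt K (monomial B j legs verts) h :=
  linearAt_monomial hD.1 (hD.mem_of_fst_mem hh)

theorem contract_monomial_congr {legs : List HalfEdge} {verts : List TriVertex} {E : Finset ℕ}
    {X Y : HalfEdge → 𝔤} (h : ∀ x ∈ allEnds legs verts, x.1 ∉ E → X x = Y x) :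
    contract p E (monomial B j legs verts) X = contract p E (monomial B j legs verts) Y :=
  (dependsOnEnds_monomial legs verts).contract_congr p E h

/-! ### Independence of the basis, and the diagram relations for the contracted weight. -/

theorem closedWeight_eq_of_isCasimirPair (hsymm : B.IsSymm) {p' : ℕ → Bool → Fin d → 𝔤}
    (hp : ∀ e, IsCasimirPair B (p e true) (p e false))
    (hp' : ∀ e, IsCasimirPair B (p' e true) (p' e false)) {legs : List HalfEdge}
    {verts : List TriVertex} (hD : IsClosedDiagram legs verts) :
    closedWeight B j p legs verts = closedWeight B j p' legs verts :=
  contract_eq_of_isCasimirPair hsymm hp hp' (fun _ hh => hD.linearAt hh) 0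

theorem vertexForm_cycEq (hsymm : B.IsSymm) (hinv : B.lieInvariant 𝔤) (X : HalfEdge → 𝔤)
    {v w : TriVertex} (h : TriVertex.CycEq v w) : vertexForm B X v = vertexForm B X w := by
  have key : ∀ x y z : 𝔤, B ⁅y, z⁆ x = B ⁅x, y⁆ z := fun x y z => by
    rw [← lie_skew x y, map_neg, LinearMap.neg_apply, hinv y x z, neg_neg, hsymm.eq]
  rcases h with rfl | rfl | rfl
  · rfl
  · exact (key _ _ _).symm
  · exact key _ _ _

theorem closedWeight_rename (hsymm : B.IsSymm) (hinv : B.lieInvariant 𝔤)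
    (hp : ∀ e, IsCasimirPair B (p e true) (p e false)) {f : HalfEdge → HalfEdge}
    (hf : Function.Injective f) (ho : ∀ x : HalfEdge, f x.opp = (f x).opp)
    {legs : List HalfEdge} {verts verts' vs : List TriVertex} (hD : IsClosedDiagram legs verts)
    (hvs : vs.Perm verts')
    (hcyc : List.Forall₂ TriVertex.CycEq (verts.map (TriVertex.rename f)) vs) :
    closedWeight B j p (legs.map f) verts' = closedWeight B j p legs verts := by
  let g : ℕ → ℕ := fun e => (f (e, true)).1
  let t : ℕ → Bool → Bool := fun e s => (f (e, s)).2
  have hfgt : ∀ h, f h = (g h.1, t h.1 h.2) := fun h =>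
    Prod.ext (rename_fst ho h.1 h.2) rfl
  have hg : Function.Injective g := rename_fst_injective hf ho
  have ht : ∀ e, t e false = !t e true := fun e => congrArg Prod.snd (ho (e, true))
  have hends : ((allEnds legs verts).map f).Perm (allEnds (legs.map f) verts') := by
    rw [← allEnds_map]
    exact (allEnds_perm_of_forall₂_cycEq hcyc).trans
      (List.Perm.append_left _ (hvs.flatMap_right _))
  have hE : edgeNames (legs.map f) verts' = (edgeNames legs verts).image g := by
    ext e
    simp only [mem_edgeNames, Finset.mem_image, ← hends.mem_iff, List.mem_map]
    constructor
    · rintro ⟨_, ⟨x, hx, rfl⟩, rfl⟩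
      exact ⟨x.1, ⟨x, hx, rfl⟩, (rename_fst ho x.1 x.2).symm⟩
    · rintro ⟨_, ⟨x, hx, rfl⟩, rfl⟩
      exact ⟨f x, ⟨x, hx, rfl⟩, rename_fst ho x.1 x.2⟩
  have hmono : ∀ X, monomial B j (legs.map f) verts' X = monomial B j legs verts (X ∘ f) := by
    intro X
    have h1 : (verts'.map (vertexForm B X)).prod =
        ((verts.map (TriVertex.rename f)).map (vertexForm B X)).prod := by
      rw [← (hvs.map (vertexForm B X)).prod_eq]
      congr 1
      clear hvs hends hE hD
      generalize verts.map (TriVertex.rename f) = ws at hcyc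
      induction hcyc with
      | nil => rfl
      | cons h _ ih => rw [List.map_cons, List.map_cons, ih, vertexForm_cycEq hsymm hinv X h]
    rw [monomial, h1, List.map_map, List.map_map, monomial]
    rfl
  rw [closedWeight, hE, contract_congr p _ hmono, contract_comp hfgt hg]
  -- The renaming may reverse an edge, which swaps the Casimir pair there. This is why the family
  -- `p` may vary from edge to edge.
  refine contract_eq_of_isCasimirPair hsymm (fun e => ?_) hp (fun _ hh => hD.linearAt hh) _
  simp only [ht]
  cases t e true
  · exact (hp (g e)).swap
  · exact hp (g e)

theorem closedWeight_nil : closedWeight B j p [] [] = 1 := by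
  rw [closedWeight, show edgeNames [] [] = ∅ from rfl, contract_empty]
  simp [monomial]

theorem closedWeight_append {legs legs' : List HalfEdge} {verts verts' : List TriVertex}
    (hE : Disjoint (edgeNames legs verts) (edgeNames legs' verts')) :
    closedWeight B j p (legs ++ legs') (verts ++ verts') =
      closedWeight B j p legs verts * closedWeight B j p legs' verts' := by
  have h1 : edgeNames (legs ++ legs') (verts ++ verts') =
      edgeNames legs verts ∪ edgeNames legs' verts' := by
    ext e
    simp only [mem_edgeNames, Finset.mem_union, mem_allEnds_append, or_and_right, exists_or]
  have h2 : ∀ X, monomial B j (legs ++ legs') (verts ++ verts') X =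
      monomial B j legs verts X * monomial B j legs' verts' X := by
    intro X
    simp only [monomial, List.map_append, List.prod_append]
    rw [smul_mul_smul_comm]
  rw [closedWeight, h1, contract_congr p _ h2]
  exact contract_mul p hE (dependsOnEnds_monomial _ _) (dependsOnEnds_monomial _ _)
    (fun _ hh => fst_mem_edgeNames hh) (fun _ hh => fst_mem_edgeNames hh) 0

/-- All edges are contracted, so the commutator formula has no free end to sum over. -/
theorem closedWeight_commute (hj : ∀ x y, j ⁅x, y⁆ = j x * j y - j y * j x)
    (hsymm : B.IsSymm) (hinv : B.lieInvariant 𝔤)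
    (hp : ∀ e, IsCasimirPair B (p e true) (p e false)) {legs : List HalfEdge}
    {verts : List TriVertex} (hD : IsClosedDiagram legs verts) (z : 𝔤) :
    j z * closedWeight B j p legs verts = closedWeight B j p legs verts * j z := by
  rw [← sub_eq_zero, closedWeight,
    commutator_contract hj hsymm hinv hD.1 hp (fun h hh => hD.mem_of_fst_mem hh)]
  refine Finset.sum_eq_zero fun h hh => ?_
  rw [Finset.mem_filter, List.mem_toFinset] at hh
  exact absurd (fst_mem_edgeNames hh.1) hh.2

/-- The weight does not change when the first leg becomes the last one. -/
theorem closedWeight_rotate [CharZero K] (hj : ∀ x y, j ⁅x, y⁆ = j x * j y - j y * j x)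
    (hsymm : B.IsSymm) (hinv : B.lieInvariant 𝔤)
    (hp : ∀ e, IsCasimirPair B (p e true) (p e false)) {x : HalfEdge} {l : List HalfEdge}
    {verts : List TriVertex} (hD : IsClosedDiagram (x :: l) verts) :
    closedWeight B j p (x :: l) verts = closedWeight B j p (l ++ [x]) verts := by
  obtain ⟨hn, hc⟩ := hD
  have hcons : allEnds (x :: l) verts = x :: allEnds l verts := rfl
  have hn' : x ∉ allEnds l verts ∧ (allEnds l verts).Nodup := by
    rwa [hcons, List.nodup_cons] at hn
  have hopp : x.opp ∈ allEnds l verts := by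
    have := hc x (by simp [hcons])
    rw [hcons, List.mem_cons] at this
    exact this.resolve_left x.opp_ne
  set E := edgeNames (x :: l) verts with hE
  have hE' : edgeNames (l ++ [x]) verts = E := by
    ext e
    simp only [hE, mem_edgeNames, allEnds, List.mem_append, List.mem_cons, List.not_mem_nil]
    refine exists_congr fun x => ?_
    tauto
  have hxE : x.1 ∈ E := fst_mem_edgeNames (by simp [hcons])
  have hmem : ∀ h : HalfEdge, h.1 ∈ E.erase x.1 → h ∈ allEnds l verts := by
    intro h hh
    rw [Finset.mem_erase] at hh
    have := IsClosedDiagram.mem_of_fst_mem ⟨hn, hc⟩ hh.2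
    rw [hcons, List.mem_cons] at this
    exact this.resolve_left fun h' => hh.1 (congrArg Prod.fst h')
  have hmono : ∀ X, monomial B j (x :: l) verts X = j (X x) * monomial B j l verts X := by
    intro X
    simp [monomial]
  have hmono' : ∀ X, monomial B j (l ++ [x]) verts X = monomial B j l verts X * j (X x) := by
    intro X
    simp [monomial]
  have hne := Finset.notMem_erase x.1 E
  -- Cut the edge of `x` open: its colour is summed last, and for each colour the two sides differ
  -- by the commutator of `j (X x)` with the contraction of `l`, whose only free end is `x.opp`.
  rw [closedWeight, closedWeight, hE', ← hE, ← Finset.insert_erase hxE, contract_insert' _ hne,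
    contract_insert' _ hne, ← sub_eq_zero,
    ← Finset.sum_sub_distrib]
  simp only [contract_congr p _ hmono, contract_congr p _ hmono']
  have hlin := (linearAt_monomial (B := B) (j := j) hn'.2 hopp).contract p (E := E.erase x.1) hne 0
  have key : ∀ i,
      contract p (E.erase x.1) (fun X => j (X x) * monomial B j l verts X)
          (setEdge 0 x.1 fun s => p x.1 s i) -
        contract p (E.erase x.1) (fun X => monomial B j l verts X * j (X x))
          (setEdge 0 x.1 fun s => p x.1 s i) =
      contract p (E.erase x.1) (monomial B j l verts)
        (Function.update 0 x.opp ⁅p x.1 x.2 i, p x.1 (!x.2) i⁆) := by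
    intro i
    set X := setEdge (0 : HalfEdge → 𝔤) x.1 (fun s => p x.1 s i) with hX
    have hXx : X x = p x.1 x.2 i := setEdge_of_eq _ _ rfl
    have hXo : X x.opp = p x.1 (!x.2) i := setEdge_of_eq _ _ rfl
    have h1 : contract p (E.erase x.1) (fun X => j (X x) * monomial B j l verts X) X =
        j (X x) * contract p (E.erase x.1) (monomial B j l verts) X := by
      simp only [contract, Finset.mul_sum, assign_of_notMem p _ X hne]
    have h2 : contract p (E.erase x.1) (fun X => monomial B j l verts X * j (X x)) X =
        contract p (E.erase x.1) (monomial B j l verts) X * j (X x) := by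
      simp only [contract, Finset.sum_mul, assign_of_notMem p _ X hne]
    rw [h1, h2, commutator_contract hj hsymm hinv hn'.2 hp hmem, Finset.sum_eq_single x.opp]
    · rw [hXx, hXo]
      -- The end `x` itself no longer occurs in `l`, so the background may be replaced by `0` away
      -- from `x.opp`; the dependence on the colour is then linear in the bracket.
      refine contract_monomial_congr fun y hy hyE => ?_
      by_cases hyx : y = x.opp
      · subst hyx
        simp
      · have h3 : y.1 ≠ x.1 := fun h => (HalfEdge.eq_or_eq_opp h).elim
          (fun h => hn'.1 (h ▸ hy)) hyx
        rw [Function.update_of_ne hyx, Function.update_of_ne hyx, hX, setEdge_of_ne _ _ h3]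
    · intro y hy hyx
      rw [Finset.mem_filter, List.mem_toFinset] at hy
      have h3 : y.1 ≠ x.1 := fun h => (HalfEdge.eq_or_eq_opp h).elim
          (fun h => hn'.1 (h ▸ hy.1)) hyx
      refine absurd (Finset.mem_erase.2 ⟨h3, fst_mem_edgeNames ?_⟩) hy.2
      exact List.mem_cons_of_mem _ hy.1
    · intro h
      exact absurd (Finset.mem_filter.2 ⟨List.mem_toFinset.2 hopp, hne⟩) h
  rw [Finset.sum_congr rfl fun i _ => key i]
  have hpair : IsCasimirPair B (p x.1 x.2) (p x.1 (!x.2)) := by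
    cases x.2
    · exact (hp x.1).swap
    · exact hp x.1
  -- The sum over colours is the value of this linear map at `∑ ⁅uᵢ, vᵢ⁆`.
  have := congrArg (hlin.mk' _) (hpair.sum_lie_eq_zero hsymm)
  rw [map_sum, map_zero] at this
  exact this

theorem IsCasimirPair.of_opp (hp : ∀ e, IsCasimirPair B (p e true) (p e false)) (x : HalfEdge) :
    IsCasimirPair B (p x.1 x.2) (p x.opp.1 x.opp.2) := by
  obtain ⟨e, s⟩ := x
  cases s
  · exact (hp e).swap
  · exact hp e

/-- The STU relation. -/
theorem closedWeight_stu (hj : ∀ x y, j ⁅x, y⁆ = j x * j y - j y * j x)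
    (hinv : B.lieInvariant 𝔤)
    (hp : ∀ e, IsCasimirPair B (p e true) (p e false)) {l₁ l₂ : List HalfEdge} {a b c : HalfEdge}
    {vs : List TriVertex} (hn : (allEnds (l₁ ++ a.opp :: l₂) ((a, b, c) :: vs)).Nodup) :
    closedWeight B j p (l₁ ++ a.opp :: l₂) ((a, b, c) :: vs) =
      closedWeight B j p (l₁ ++ b :: c :: l₂) vs - closedWeight B j p (l₁ ++ c :: b :: l₂) vs := by
  have hperm : (allEnds (l₁ ++ a.opp :: l₂) ((a, b, c) :: vs)).Perm
      (a :: a.opp :: allEnds (l₁ ++ b :: c :: l₂) vs) := by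
    classical
    rw [List.perm_iff_count]
    intro x
    simp only [allEnds, List.count_append, List.flatMap_cons, TriVertex.ends, List.count_cons,
      List.count_nil]
    omega
  have hn2 := hperm.nodup_iff.1 hn
  simp only [List.nodup_cons, List.mem_cons, not_or] at hn2
  have hne : ∀ y ∈ allEnds (l₁ ++ b :: c :: l₂) vs, y.1 ≠ a.1 := fun y hy h =>
    (HalfEdge.eq_or_eq_opp h).elim (fun h => hn2.1.2 (h ▸ hy)) (fun h => hn2.2.1 (h ▸ hy))
  set E := edgeNames (l₁ ++ b :: c :: l₂) vs with hE
  have hE1 : edgeNames (l₁ ++ a.opp :: l₂) ((a, b, c) :: vs) = insert a.1 E := by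
    ext e
    simp only [hE, mem_edgeNames, Finset.mem_insert, hperm.mem_iff, List.mem_cons]
    constructor
    · rintro ⟨x, rfl | rfl | hx, rfl⟩
      · exact Or.inl rfl
      · exact Or.inl rfl
      · exact Or.inr ⟨x, hx, rfl⟩
    · rintro (rfl | ⟨x, hx, rfl⟩)
      · exact ⟨a, Or.inl rfl, rfl⟩
      · exact ⟨x, Or.inr (Or.inr hx), rfl⟩
  have hE2 : edgeNames (l₁ ++ c :: b :: l₂) vs = E := by
    ext e
    simp only [hE, mem_edgeNames, allEnds, List.mem_append, List.mem_cons]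
    refine exists_congr fun x => ?_
    tauto
  have haE : a.1 ∉ E := fun h => by
    obtain ⟨y, hy, hya⟩ := mem_edgeNames.1 h
    exact hne y hy hya
  -- With the edge of `a` contracted innermost, the relation already holds for each colouring of the
  -- other edges, which are the same in all three diagrams.
  rw [closedWeight, closedWeight, closedWeight, hE1, hE2, ← hE, contract_insert _ haE, contract,
    contract, contract, ← Finset.sum_sub_distrib]
  refine Finset.sum_congr rfl fun κ _ => ?_
  generalize assign p E κ 0 = Y
  have hY : ∀ (u : Bool → 𝔤), ∀ y ∈ allEnds (l₁ ++ b :: c :: l₂) vs, setEdge Y a.1 u y = Y y :=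
    fun u y hy => setEdge_of_ne _ _ (hne y hy)
  have hmono : ∀ i, monomial B j (l₁ ++ a.opp :: l₂) ((a, b, c) :: vs)
      (setEdge Y a.1 fun s => p a.1 s i) =
      (vs.map (vertexForm B Y)).prod • ((l₁.map fun x => j (Y x)).prod *
        (j (B (p a.1 a.2 i) ⁅Y b, Y c⁆ • p a.opp.1 a.opp.2 i) *
          (l₂.map fun x => j (Y x)).prod)) := by
    intro i
    have h1 : ∀ x ∈ l₁, j (setEdge Y a.1 (fun s => p a.1 s i) x) = j (Y x) := fun x hx => by
      rw [hY _ x (mem_allEnds_left (by simp [hx]))]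
    have h2 : ∀ x ∈ l₂, j (setEdge Y a.1 (fun s => p a.1 s i) x) = j (Y x) := fun x hx => by
      rw [hY _ x (mem_allEnds_left (by simp [hx]))]
    have h3 : ∀ v ∈ vs, vertexForm B (setEdge Y a.1 (fun s => p a.1 s i)) v =
        vertexForm B Y v := by
      intro v hv
      rw [vertexForm, vertexForm, hY _ v.1 (mem_allEnds_right hv (by simp [TriVertex.ends])),
        hY _ v.2.1 (mem_allEnds_right hv (by simp [TriVertex.ends])),
        hY _ v.2.2 (mem_allEnds_right hv (by simp [TriVertex.ends]))]
    have h4 : vertexForm B (setEdge Y a.1 (fun s => p a.1 s i)) (a, b, c) =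
        B (p a.1 a.2 i) ⁅Y b, Y c⁆ := by
      simp only [vertexForm]
      rw [hY _ b (mem_allEnds_left (by simp)), hY _ c (mem_allEnds_left (by simp)),
        setEdge_of_eq _ _ rfl, ← lie_skew, map_neg, LinearMap.neg_apply, hinv, neg_neg]
    rw [monomial, List.map_cons, List.prod_cons, List.map_append, List.map_cons, List.prod_append,
      List.prod_cons, List.map_congr_left h1, List.map_congr_left h2, List.map_congr_left h3, h4,
      setEdge_of_eq _ _ a.opp_fst, map_smul, smul_mul_assoc, mul_smul_comm, smul_smul, mul_comm]
    rfl
  simp only [hmono]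
  -- The Casimir pair carries the vector `⁅Y b, Y c⁆` along the edge to the leg, where `j` turns it
  -- into a commutator.
  rw [← Finset.smul_sum, ← Finset.mul_sum, ← Finset.sum_mul, ← map_sum,
    (IsCasimirPair.of_opp hp a).1, hj]
  simp only [monomial, List.map_append, List.map_cons, List.prod_append, List.prod_cons]
  rw [← smul_sub]
  congr 1
  noncomm_ring

/-- By uniqueness of the Casimir tensor, the pair on any edge, read in either direction, gives the
same Casimir element. -/
theorem closedWeight_chord (hsymm : B.IsSymm)
    (hp : ∀ e, IsCasimirPair B (p e true) (p e false)) (x : HalfEdge) :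
    closedWeight B j p [(0, true), (0, false)] [] =
      ∑ i, j (p x.1 x.2 i) * j (p x.opp.1 x.opp.2 i) := by
  have h1 : edgeNames [(0, true), (0, false)] [] = insert 0 ∅ := rfl
  rw [closedWeight, h1, contract_insert' _ (Finset.notMem_empty 0)]
  have h2 := (hp 0).sum_eq hsymm (IsCasimirPair.of_opp hp x) ((LinearMap.mul K A).compl₁₂ j j)
  simp only [LinearMap.compl₁₂_apply, LinearMap.mul_apply'] at h2
  rw [← h2]
  refine Finset.sum_congr rfl fun i _ => ?_
  simp [monomial, setEdge]

theorem closedWeight_chord_commute (hj : ∀ x y, j ⁅x, y⁆ = j x * j y - j y * j x)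
    (hsymm : B.IsSymm) (hinv : B.lieInvariant 𝔤)
    (hp : ∀ e, IsCasimirPair B (p e true) (p e false)) (z : 𝔤) :
    j z * closedWeight B j p [(0, true), (0, false)] [] =
      closedWeight B j p [(0, true), (0, false)] [] * j z :=
  closedWeight_commute hj hsymm hinv hp isClosedDiagram_chord z

/-- An isolated chord contributes the Casimir element. -/
theorem closedWeight_isolated (hj : ∀ x y, j ⁅x, y⁆ = j x * j y - j y * j x)
    (hsymm : B.IsSymm) (hinv : B.lieInvariant 𝔤)
    (hp : ∀ e, IsCasimirPair B (p e true) (p e false)) {l₁ l₂ : List HalfEdge} {x : HalfEdge}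
    {vs : List TriVertex} (hn : (allEnds (l₁ ++ x :: x.opp :: l₂) vs).Nodup) :
    closedWeight B j p (l₁ ++ x :: x.opp :: l₂) vs =
      closedWeight B j p [(0, true), (0, false)] [] * closedWeight B j p (l₁ ++ l₂) vs := by
  have hperm : (allEnds (l₁ ++ x :: x.opp :: l₂) vs).Perm
      (x :: x.opp :: allEnds (l₁ ++ l₂) vs) := by
    classical
    rw [List.perm_iff_count]
    intro x
    simp only [allEnds, List.count_append, List.count_cons]
    omega
  have hn2 := hperm.nodup_iff.1 hn
  simp only [List.nodup_cons, List.mem_cons, not_or] at hn2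
  have hne : ∀ y ∈ allEnds (l₁ ++ l₂) vs, y.1 ≠ x.1 := fun y hy h =>
    (HalfEdge.eq_or_eq_opp h).elim (fun h => hn2.1.2 (h ▸ hy)) (fun h => hn2.2.1 (h ▸ hy))
  set E := edgeNames (l₁ ++ l₂) vs with hE
  have hE1 : edgeNames (l₁ ++ x :: x.opp :: l₂) vs = insert x.1 E := by
    ext e
    simp only [hE, mem_edgeNames, Finset.mem_insert, hperm.mem_iff, List.mem_cons]
    constructor
    · rintro ⟨y, rfl | rfl | hy, rfl⟩
      · exact Or.inl rfl
      · exact Or.inl rfl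
      · exact Or.inr ⟨y, hy, rfl⟩
    · rintro (rfl | ⟨y, hy, rfl⟩)
      · exact ⟨x, Or.inl rfl, rfl⟩
      · exact ⟨y, Or.inr (Or.inr hy), rfl⟩
  have hxE : x.1 ∉ E := fun h => by
    obtain ⟨y, hy, hyx⟩ := mem_edgeNames.1 h
    exact hne y hy hyx
  set C := closedWeight B j p [(0, true), (0, false)] [] with hC
  -- Contracting the chord leaves `C` between the legs of `l₁` and those of `l₂`; it must be moved
  -- to the front.
  have hCj : ∀ l : List A, (∀ y ∈ l, ∃ z, y = j z) → C * l.prod = l.prod * C := by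
    intro l hl
    induction l with
    | nil => simp
    | cons y l ih =>
      obtain ⟨z, rfl⟩ := hl y (by simp)
      rw [List.prod_cons, ← mul_assoc, ← closedWeight_chord_commute hj hsymm hinv hp, ← hC,
        mul_assoc, ih fun y hy => hl y (by simp [hy]), mul_assoc]
  rw [closedWeight, closedWeight, hE1, ← hE, contract_insert _ hxE, contract,
    contract, Finset.mul_sum]
  refine Finset.sum_congr rfl fun κ _ => ?_
  generalize assign p E κ 0 = Y
  have hmono : ∀ i, monomial B j (l₁ ++ x :: x.opp :: l₂) vs
      (setEdge Y x.1 fun s => p x.1 s i) =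
      (vs.map (vertexForm B Y)).prod • ((l₁.map fun x => j (Y x)).prod *
        (j (p x.1 x.2 i) * j (p x.opp.1 x.opp.2 i) * (l₂.map fun x => j (Y x)).prod)) := by
    intro i
    have h1 : ∀ y ∈ l₁, j (setEdge Y x.1 (fun s => p x.1 s i) y) = j (Y y) := fun y hy => by
      rw [setEdge_of_ne _ _ (hne y (mem_allEnds_left (by simp [hy])))]
    have h2 : ∀ y ∈ l₂, j (setEdge Y x.1 (fun s => p x.1 s i) y) = j (Y y) := fun y hy => by
      rw [setEdge_of_ne _ _ (hne y (mem_allEnds_left (by simp [hy])))]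
    have h3 : ∀ v ∈ vs, vertexForm B (setEdge Y x.1 (fun s => p x.1 s i)) v =
        vertexForm B Y v := by
      intro v hv
      have h4 : ∀ y ∈ v.ends, setEdge Y x.1 (fun s => p x.1 s i) y = Y y := fun y hy =>
        setEdge_of_ne _ _ (hne y (mem_allEnds_right hv hy))
      rw [vertexForm, vertexForm, h4 v.1 (by simp [TriVertex.ends]),
        h4 v.2.1 (by simp [TriVertex.ends]), h4 v.2.2 (by simp [TriVertex.ends])]
    rw [monomial, List.map_append, List.map_cons, List.map_cons, List.prod_append,
      List.prod_cons, List.prod_cons, List.map_congr_left h1, List.map_congr_left h2,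
      List.map_congr_left h3, setEdge_of_eq _ _ x.opp_fst, setEdge_of_eq _ _ rfl, ← mul_assoc (j _)]
    rfl
  simp only [hmono]
  rw [← Finset.smul_sum, ← Finset.mul_sum, ← Finset.sum_mul, ← closedWeight_chord hsymm hp, ← hC,
    monomial, List.map_append, List.prod_append, mul_smul_comm, ← mul_assoc, ← mul_assoc,
    hCj (l₁.map fun x => j (Y x)) fun y hy => ?_]
  obtain ⟨z, -, rfl⟩ := List.mem_map.1 hy
  exact ⟨_, rfl⟩

end ClosedWeight

/-! ### Deframing -/

section Deframing

theorem mem_chordNames {legs : List HalfEdge} {x : HalfEdge} :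
    x.1 ∈ chordNames legs ↔ x ∈ legs ∧ x.opp ∈ legs := by
  have h : ∀ e, e ∈ chordNames legs ↔ (e, true) ∈ legs ∧ (e, false) ∈ legs := by
    intro e
    simp only [chordNames, Finset.mem_filter, List.mem_toFinset, List.mem_map,
      and_iff_right_iff_imp]
    exact fun h => ⟨_, h.1, rfl⟩
  rw [h]
  obtain ⟨e, s⟩ := x
  cases s
  · exact and_comm
  · exact Iff.rfl

/-- Both ends of a chord are legs, and no half-edge is attached twice; hence deleting chords leaves
the trivalent vertices intact. -/
theorem IsClosedDiagram.not_mem_chordNames {legs : List HalfEdge} {verts : List TriVertex}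
    (hn : (allEnds legs verts).Nodup) {v : TriVertex} (hv : v ∈ verts) {x : HalfEdge}
    (hx : x ∈ v.ends) : x.1 ∉ chordNames legs := fun h =>
  (List.nodup_append'.1 hn).2.2 (mem_chordNames.1 h).1 (List.mem_flatMap.2 ⟨v, hv, hx⟩)

theorem allEnds_filter_sublist (q : HalfEdge → Bool) (legs : List HalfEdge)
    (verts : List TriVertex) : (allEnds (legs.filter q) verts).Sublist (allEnds legs verts) :=
  List.filter_sublist.append_right _

theorem IsClosedDiagram.filter {legs : List HalfEdge} {verts : List TriVertex}
    (hD : IsClosedDiagram legs verts) {S : Finset ℕ} (hS : S ⊆ chordNames legs) :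
    IsClosedDiagram (legs.filter fun x => x.1 ∉ S) verts := by
  refine ⟨hD.1.sublist (allEnds_filter_sublist _ _ _), fun x hx => ?_⟩
  have hmem : ∀ y, y ∈ allEnds (legs.filter fun x => x.1 ∉ S) verts ↔
      y ∈ allEnds legs verts ∧ y.1 ∉ S := by
    intro y
    simp only [allEnds, List.mem_append, List.mem_filter, decide_eq_true_eq, or_and_right]
    refine or_congr_right ⟨fun h => ⟨h, fun hy => ?_⟩, And.left⟩
    obtain ⟨v, hv, hyv⟩ := List.mem_flatMap.1 h
    exact IsClosedDiagram.not_mem_chordNames hD.1 hv hyv (hS hy)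
  rw [hmem] at hx ⊢
  exact ⟨hD.2 x hx.1, hx.2⟩

variable {A : Type*} [Ring A]

/-- The relations between diagrams other than 1T, for a function on diagrams. -/
structure IsDiagramWeight (w : List HalfEdge → List TriVertex → A) : Prop where
  rename : ∀ (f : HalfEdge → HalfEdge) (legs : List HalfEdge) (verts verts' vs : List TriVertex),
    Function.Injective f → (∀ x : HalfEdge, f x.opp = (f x).opp) → IsClosedDiagram legs verts →
    vs.Perm verts' → List.Forall₂ TriVertex.CycEq (verts.map (TriVertex.rename f)) vs →
    w (legs.map f) verts' = w legs verts
  nil : w [] [] = 1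
  append : ∀ (legs legs' : List HalfEdge) (verts verts' : List TriVertex),
    IsClosedDiagram legs verts → IsClosedDiagram legs' verts' →
    Disjoint (edgeNames legs verts) (edgeNames legs' verts') →
    w (legs ++ legs') (verts ++ verts') = w legs verts * w legs' verts'
  rotate : ∀ (x : HalfEdge) (l : List HalfEdge) (verts : List TriVertex),
    IsClosedDiagram (x :: l) verts → w (x :: l) verts = w (l ++ [x]) verts
  stu : ∀ (l₁ l₂ : List HalfEdge) (a b c : HalfEdge) (vs : List TriVertex),
    (allEnds (l₁ ++ a.opp :: l₂) ((a, b, c) :: vs)).Nodup →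
    w (l₁ ++ a.opp :: l₂) ((a, b, c) :: vs) = w (l₁ ++ b :: c :: l₂) vs - w (l₁ ++ c :: b :: l₂) vs

/-- The alternating sum over the sets of chords. -/
def deframed (C : A) (w : List HalfEdge → List TriVertex → A) (legs : List HalfEdge)
    (verts : List TriVertex) : A :=
  ∑ S ∈ (chordNames legs).powerset, (-C) ^ S.card * w (legs.filter fun x => x.1 ∉ S) verts

variable {C : A} {w : List HalfEdge → List TriVertex → A}

/-! ### The diagram relations for the alternating sum over sets of chords. -/

theorem chordNames_map {f : HalfEdge → HalfEdge} (hf : Function.Injective f)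
    (ho : ∀ x : HalfEdge, f x.opp = (f x).opp) (legs : List HalfEdge) :
    chordNames (legs.map f) = (chordNames legs).image fun e => (f (e, true)).1 := by
  have key : ∀ x, (f x).1 ∈ chordNames (legs.map f) ↔ x.1 ∈ chordNames legs := by
    intro x
    rw [mem_chordNames, mem_chordNames, ← ho, List.mem_map_of_injective hf,
      List.mem_map_of_injective hf]
  ext e
  rw [Finset.mem_image]
  constructor
  · intro he
    obtain ⟨x, -, hx⟩ := List.mem_map.1 (mem_chordNames (x := (e, true)).1 he).1
    have hxe : (f x).1 = e := congrArg Prod.fst hx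
    refine ⟨x.1, (key x).1 (hxe ▸ he), ?_⟩
    rw [← rename_fst ho x.1 x.2, ← hxe]
  · rintro ⟨n, hn, rfl⟩
    exact (key (n, true)).2 hn

theorem IsDiagramWeight.deframed_rename (hw : IsDiagramWeight w) {f : HalfEdge → HalfEdge}
    {legs : List HalfEdge} {verts verts' vs : List TriVertex} (hf : Function.Injective f)
    (ho : ∀ x : HalfEdge, f x.opp = (f x).opp) (hD : IsClosedDiagram legs verts)
    (hvs : vs.Perm verts')
    (hcyc : List.Forall₂ TriVertex.CycEq (verts.map (TriVertex.rename f)) vs) :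
    deframed C w (legs.map f) verts' = deframed C w legs verts := by
  have hg := rename_fst_injective hf ho
  rw [deframed, chordNames_map hf ho, Finset.powerset_image,
    Finset.sum_image (Finset.image_injective hg).injOn]
  refine Finset.sum_congr rfl fun S hS => ?_
  rw [Finset.card_image_of_injective _ hg, ← hw.rename f _ verts verts' vs hf ho
    (hD.filter (Finset.mem_powerset.1 hS)) hvs hcyc, List.filter_map]
  congr 3
  refine List.filter_congr fun x _ => ?_
  simp only [Function.comp_apply]
  have : (f x).1 = (f (x.1, true)).1 := rename_fst ho x.1 x.2
  rw [this]
  exact decide_eq_decide.2 (not_congr (hg.mem_finset_image (s := S) (a := x.1)))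

theorem IsDiagramWeight.deframed_nil (hw : IsDiagramWeight w) : deframed C w [] [] = 1 := by
  rw [deframed, show chordNames [] = ∅ from rfl, Finset.powerset_empty, Finset.sum_singleton]
  simp [hw.nil]

/-- A set of chords of the connected sum is a pair of sets of chords of the two summands, and `C`
commutes with the weights, so the double sum factors. -/
theorem IsDiagramWeight.deframed_append (hw : IsDiagramWeight w)
    (hC : ∀ legs verts, IsClosedDiagram legs verts → Commute C (w legs verts))
    {legs legs' : List HalfEdge} {verts verts' : List TriVertex}
    (hD : IsClosedDiagram legs verts) (hD' : IsClosedDiagram legs' verts')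
    (hE : Disjoint (edgeNames legs verts) (edgeNames legs' verts')) :
    deframed C w (legs ++ legs') (verts ++ verts') =
      deframed C w legs verts * deframed C w legs' verts' := by
  have hdis : ∀ x ∈ legs, ∀ y ∈ legs', x.1 ≠ y.1 := fun x hx y hy h =>
    Finset.disjoint_left.1 hE (fst_mem_edgeNames (mem_allEnds_left hx))
      (h ▸ fst_mem_edgeNames (mem_allEnds_left hy))
  have hch : chordNames (legs ++ legs') = chordNames legs ∪ chordNames legs' := by
    ext e
    have h : ∀ l, e ∈ chordNames l ↔ (e, true) ∈ l ∧ HalfEdge.opp (e, true) ∈ l :=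
      fun l => mem_chordNames (x := (e, true))
    simp only [Finset.mem_union, h, List.mem_append]
    constructor
    · rintro ⟨h5 | h5, h6 | h6⟩
      · exact Or.inl ⟨h5, h6⟩
      · exact (hdis _ h5 _ h6 rfl).elim
      · exact (hdis _ h6 _ h5 rfl).elim
      · exact Or.inr ⟨h5, h6⟩
    · rintro (⟨h5, h6⟩ | ⟨h5, h6⟩)
      · exact ⟨Or.inl h5, Or.inl h6⟩
      · exact ⟨Or.inr h5, Or.inr h6⟩
  have hchd : Disjoint (chordNames legs) (chordNames legs') := by
    rw [Finset.disjoint_left]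
    intro e he he'
    exact hdis _ (mem_chordNames (x := (e, true)).1 he).1 _
      (mem_chordNames (x := (e, true)).1 he').1 rfl
  rw [deframed, deframed, deframed, Finset.sum_mul_sum, ← Finset.sum_product', hch]
  symm
  refine Finset.sum_bij' (fun q _ => q.1 ∪ q.2)
    (fun S _ => (S ∩ chordNames legs, S ∩ chordNames legs')) ?_ ?_ ?_ ?_ ?_
  · intro q hq
    simp only [Finset.mem_product, Finset.mem_powerset] at hq ⊢
    exact Finset.union_subset_union hq.1 hq.2
  · intro S hS
    simp [Finset.inter_subset_right]
  · rintro ⟨S, T⟩ hq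
    simp only [Finset.mem_product, Finset.mem_powerset] at hq
    have h1 : T ∩ chordNames legs = ∅ :=
      Finset.disjoint_iff_inter_eq_empty.1 (hchd.symm.mono_left hq.2)
    have h2 : S ∩ chordNames legs' = ∅ :=
      Finset.disjoint_iff_inter_eq_empty.1 (hchd.mono_left hq.1)
    simp only [Finset.union_inter_distrib_right, h1, h2, Finset.inter_eq_left.2 hq.1,
      Finset.inter_eq_left.2 hq.2, Finset.union_empty, Finset.empty_union]
  · intro S hS
    simp only [← Finset.inter_union_distrib_left]
    exact Finset.inter_eq_left.2 (Finset.mem_powerset.1 hS)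
  · rintro ⟨S, T⟩ hq
    simp only [Finset.mem_product, Finset.mem_powerset] at hq
    have h1 : legs.filter (fun x => x.1 ∉ S ∪ T) = legs.filter fun x => x.1 ∉ S := by
      refine List.filter_congr fun x hx => ?_
      have : x.1 ∉ T := fun h => hdis x hx x (mem_chordNames.1 (hq.2 h)).1 rfl
      simp [this]
    have h2 : legs'.filter (fun x => x.1 ∉ S ∪ T) = legs'.filter fun x => x.1 ∉ T := by
      refine List.filter_congr fun x hx => ?_
      have : x.1 ∉ S := fun h => hdis x (mem_chordNames.1 (hq.1 h)).1 x hx rfl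
      simp [this]
    have h3 : ∀ (q : HalfEdge → Bool) l v, edgeNames (l.filter q) v ⊆ edgeNames l v := by
      intro q l v e he
      obtain ⟨x, hx, rfl⟩ := mem_edgeNames.1 he
      exact fst_mem_edgeNames ((allEnds_filter_sublist _ _ _).subset hx)
    simp only []
    rw [List.filter_append, h1, h2, hw.append _ _ _ _ (hD.filter hq.1) (hD'.filter hq.2)
      (hE.mono (h3 _ _ _) (h3 _ _ _)), Finset.card_union_of_disjoint (hchd.mono hq.1 hq.2),
      pow_add]
    have h4 := ((hC _ _ (hD.filter hq.1)).neg_left.pow_left T.card).eq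
    simp only [mul_assoc]
    rw [← mul_assoc ((-C) ^ T.card), h4, mul_assoc]

theorem chordNames_perm {l l' : List HalfEdge} (h : l.Perm l') : chordNames l = chordNames l' := by
  ext e
  have h1 : ∀ l, e ∈ chordNames l ↔ _ := fun l => mem_chordNames (legs := l) (x := (e, true))
  rw [h1, h1, h.mem_iff, h.mem_iff]

theorem IsDiagramWeight.deframed_rotate (hw : IsDiagramWeight w) {x : HalfEdge}
    {l : List HalfEdge} {verts : List TriVertex} (hD : IsClosedDiagram (x :: l) verts) :
    deframed C w (x :: l) verts = deframed C w (l ++ [x]) verts := by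
  have hp : (x :: l).Perm (l ++ [x]) := List.perm_append_comm (l₁ := [x])
  rw [deframed, deframed, ← chordNames_perm hp]
  refine Finset.sum_congr rfl fun S hS => ?_
  congr 1
  have hF := hD.filter (Finset.mem_powerset.1 hS)
  rw [List.filter_append]
  by_cases hx : x.1 ∈ S
  · simp [hx]
  · have h1 : (x :: l).filter (fun x => x.1 ∉ S) = x :: l.filter fun x => x.1 ∉ S := by
      simp [hx]
    rw [h1] at hF ⊢
    rw [hw.rotate _ _ _ hF]
    simp [hx]

/-- The two resolved diagrams may acquire new chords, namely the edges of `b` and `c`. Sets avoiding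
both give STU term by term; once a set contains one of them, deleting it makes the two resolutions
equal and their terms cancel. -/
theorem IsDiagramWeight.deframed_stu (hw : IsDiagramWeight w) {l₁ l₂ : List HalfEdge}
    {a b c : HalfEdge} {vs : List TriVertex}
    (hn : (allEnds (l₁ ++ a.opp :: l₂) ((a, b, c) :: vs)).Nodup) :
    deframed C w (l₁ ++ a.opp :: l₂) ((a, b, c) :: vs) =
      deframed C w (l₁ ++ b :: c :: l₂) vs - deframed C w (l₁ ++ c :: b :: l₂) vs := by
  have hnot := fun x hx => IsClosedDiagram.not_mem_chordNames hn
    (v := (a, b, c)) (x := x) (by simp) hx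
  have ha := hnot a (by simp [TriVertex.ends])
  have hb := hnot b (by simp [TriVertex.ends])
  have hc := hnot c (by simp [TriVertex.ends])
  have hp : (l₁ ++ c :: b :: l₂).Perm (l₁ ++ b :: c :: l₂) :=
    (List.Perm.swap b c l₂).append_left l₁
  have hS : ∀ x : HalfEdge, x.1 ∈ chordNames (l₁ ++ a.opp :: l₂) → x ∈ l₁ ∨ x ∈ l₂ := by
    intro x hx
    have := (mem_chordNames.1 hx).1
    simp only [List.mem_append, List.mem_cons] at this
    rcases this with h | rfl | h
    · exact Or.inl h
    · exact absurd hx ha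
    · exact Or.inr h
  have hsub : chordNames (l₁ ++ a.opp :: l₂) ⊆ chordNames (l₁ ++ b :: c :: l₂) := by
    intro e he
    refine mem_chordNames (x := (e, true)).2 ⟨?_, ?_⟩
    · have := hS (e, true) he
      simp only [List.mem_append, List.mem_cons]
      tauto
    · have := hS (HalfEdge.opp (e, true)) he
      simp only [List.mem_append, List.mem_cons]
      tauto
  rw [deframed, deframed, deframed, chordNames_perm hp, ← Finset.sum_sub_distrib,
    ← Finset.sum_subset (Finset.powerset_mono.2 hsub)]
  · refine Finset.sum_congr rfl fun S hSS => ?_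
    rw [Finset.mem_powerset] at hSS
    have ha' : a.1 ∉ S := fun h => ha (hSS h)
    have hb' : b.1 ∉ S := fun h => hb (hSS h)
    have hc' : c.1 ∉ S := fun h => hc (hSS h)
    have h1 : (l₁ ++ a.opp :: l₂).filter (fun x => x.1 ∉ S) =
        l₁.filter (fun x => x.1 ∉ S) ++ a.opp :: l₂.filter fun x => x.1 ∉ S := by
      simp [ha']
    have h2 : (l₁ ++ b :: c :: l₂).filter (fun x => x.1 ∉ S) =
        l₁.filter (fun x => x.1 ∉ S) ++ b :: c :: l₂.filter fun x => x.1 ∉ S := by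
      simp [hb', hc']
    have h3 : (l₁ ++ c :: b :: l₂).filter (fun x => x.1 ∉ S) =
        l₁.filter (fun x => x.1 ∉ S) ++ c :: b :: l₂.filter fun x => x.1 ∉ S := by
      simp [hb', hc']
    have hn' := hn.sublist (allEnds_filter_sublist (fun x => x.1 ∉ S) _ _)
    rw [h1] at hn' ⊢
    rw [h2, h3, hw.stu _ _ _ _ _ _ hn', mul_sub]
  -- A set of chords that is not available before the resolution must contain the edge of `b` or of
  -- `c`; after its deletion the order of the two legs is immaterial.
  · intro S hST hSS
    have hbc : b.1 ∈ S ∨ c.1 ∈ S := by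
      by_contra! hbc
      refine hSS (Finset.mem_powerset.2 fun e he => ?_)
      have heT := mem_chordNames (x := (e, true)).1 (Finset.mem_powerset.1 hST he)
      have key : ∀ x : HalfEdge, x.1 = e → x ∈ l₁ ++ b :: c :: l₂ → x ∈ l₁ ++ a.opp :: l₂ := by
        intro x hx hxT
        have hxb : x ≠ b := fun h => hbc.1 (h ▸ hx.symm ▸ he)
        have hxc : x ≠ c := fun h => hbc.2 (h ▸ hx.symm ▸ he)
        simp only [List.mem_append, List.mem_cons] at hxT ⊢
        tauto
      exact mem_chordNames (x := (e, true)).2 ⟨key _ rfl heT.1, key _ rfl heT.2⟩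
    rw [sub_eq_zero]
    congr 2
    simp only [List.filter_append, List.filter_cons]
    rcases hbc with h | h <;> simp [h]

/-- Pair each set `S` not containing the isolated chord with `S` enlarged by it: keeping the chord
yields a factor `C`, deleting it a factor `-C`. -/
theorem deframed_isolated {l₁ l₂ : List HalfEdge} {x : HalfEdge} {verts : List TriVertex}
    (hiso : ∀ (l₁ l₂ : List HalfEdge) (x : HalfEdge) (vs : List TriVertex),
      (allEnds (l₁ ++ x :: x.opp :: l₂) vs).Nodup →
      w (l₁ ++ x :: x.opp :: l₂) vs = C * w (l₁ ++ l₂) vs)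
    (hn : (allEnds (l₁ ++ x :: x.opp :: l₂) verts).Nodup) :
    deframed C w (l₁ ++ x :: x.opp :: l₂) verts = 0 := by
  have hx : x.1 ∈ chordNames (l₁ ++ x :: x.opp :: l₂) := mem_chordNames.2 (by simp)
  have hp : (l₁ ++ x :: x.opp :: l₂).Perm (x :: x.opp :: (l₁ ++ l₂)) := by
    classical
    rw [List.perm_iff_count]
    intro x
    simp only [List.count_append, List.count_cons]
    omega
  have hn2 := hp.nodup_iff.1 (List.nodup_append'.1 hn).1
  simp only [List.nodup_cons, List.mem_cons, not_or] at hn2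
  have hne : ∀ y ∈ l₁ ++ l₂, y.1 ≠ x.1 := fun y hy h =>
    (HalfEdge.eq_or_eq_opp h).elim (fun h => hn2.1.2 (h ▸ hy)) (fun h => hn2.2.1 (h ▸ hy))
  rw [deframed, ← Finset.insert_erase hx, Finset.sum_powerset_insert (Finset.notMem_erase _ _),
    ← Finset.sum_add_distrib]
  refine Finset.sum_eq_zero fun S hS => ?_
  rw [Finset.mem_powerset] at hS
  have hxS : x.1 ∉ S := fun h => Finset.notMem_erase _ _ (hS h)
  have h1 : (l₁ ++ x :: x.opp :: l₂).filter (fun y => y.1 ∉ S) =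
      l₁.filter (fun y => y.1 ∉ S) ++ x :: x.opp :: l₂.filter fun y => y.1 ∉ S := by
    simp [hxS]
  have h2 : (l₁ ++ x :: x.opp :: l₂).filter (fun y => y.1 ∉ insert x.1 S) =
      l₁.filter (fun y => y.1 ∉ S) ++ l₂.filter fun y => y.1 ∉ S := by
    have h3 : (l₁ ++ x :: x.opp :: l₂).filter (fun y => y.1 ∉ insert x.1 S) =
        (l₁ ++ l₂).filter (fun y => y.1 ∉ insert x.1 S) := by
      simp
    rw [h3, ← List.filter_append]
    exact List.filter_congr fun y hy => by simp [hne y hy]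
  have hn' := hn.sublist (allEnds_filter_sublist (fun y => y.1 ∉ S) _ _)
  rw [h1] at hn' ⊢
  rw [h2, hiso _ _ _ _ hn', Finset.card_insert_of_notMem hxS, pow_succ]
  simp [mul_assoc]

theorem IsDiagramWeight.deframed (hw : IsDiagramWeight w)
    (hC : ∀ legs verts, IsClosedDiagram legs verts → Commute C (w legs verts)) :
    IsDiagramWeight (deframed C w) where
  rename _ _ _ _ _ hf ho hD hvs hcyc := hw.deframed_rename hf ho hD hvs hcyc
  nil := hw.deframed_nil
  append _ _ _ _ hD hD' hE := hw.deframed_append hC hD hD' hE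
  rotate _ _ _ hD := hw.deframed_rotate hD
  stu _ _ _ _ _ _ hn := hw.deframed_stu hn

end Deframing

/-! ### Homomorphisms on the algebra of diagrams -/

section DiagramAlgebra

theorem DiagAlg.induction {oneT : Prop} {P : DiagAlg oneT → Prop}
    (algebraMap : ∀ q : ℚ, P (algebraMap ℚ (DiagAlg oneT) q))
    (of : ∀ D, P (DiagAlg.of oneT D)) (mul : ∀ x y, P x → P y → P (x * y))
    (add : ∀ x y, P x → P y → P (x + y)) (x : DiagAlg oneT) : P x := by
  obtain ⟨y, rfl⟩ := RingQuot.mkAlgHom_surjective ℚ (DiagRel oneT) x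
  induction y using FreeAlgebra.induction with
  | grade0 q => rw [AlgHom.commutes]; exact algebraMap q
  | grade1 D => exact of D
  | mul x y hx hy => rw [map_mul]; exact mul _ _ hx hy
  | add x y hx hy => rw [map_add]; exact add _ _ hx hy

theorem UTDiagram.disjoint_edgeNames {D₁ D₂ D : UTDiagram} (hl : D.legs = D₁.legs ++ D₂.legs)
    (hv : D.verts = D₁.verts ++ D₂.verts) :
    Disjoint (edgeNames D₁.legs D₁.verts) (edgeNames D₂.legs D₂.verts) := by
  have hn := D.nodup
  rw [hl, hv, ← (allEnds_append_perm _ _ _ _).nodup_iff, List.nodup_append'] at hn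
  rw [Finset.disjoint_left]
  intro e he he'
  exact hn.2.2 (D₁.isClosedDiagram.mem_of_fst_mem (x := (e, true)) he)
    (D₂.isClosedDiagram.mem_of_fst_mem (x := (e, true)) he')

variable {K A : Type*} [Field K] [CharZero K] [Ring A] [Algebra K A]

/-- A function on diagrams that satisfies the relations extends to the algebra of diagrams. -/
theorem IsDiagramWeight.exists_ringHom {w : List HalfEdge → List TriVertex → A}
    (hw : IsDiagramWeight w) {oneT : Prop}
    (hiso : oneT → ∀ (l₁ l₂ : List HalfEdge) (x : HalfEdge) (vs : List TriVertex),
      (allEnds (l₁ ++ x :: x.opp :: l₂) vs).Nodup → w (l₁ ++ x :: x.opp :: l₂) vs = 0) :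
    ∃ R : DiagAlg oneT →+* A, (∀ D, R (DiagAlg.of oneT D) = w D.legs D.verts) ∧
      ∀ (q : ℚ) x, R (q • x) = algebraMap ℚ K q • R x := by
  -- The rational structure on `A` is the one inherited from `K`. It stays local to the proof, so
  -- the conclusion states rational linearity through scalars of `K`.
  let _ : Algebra ℚ A := Algebra.compHom A (algebraMap ℚ K)
  have hrel : ∀ ⦃x y⦄, DiagRel oneT x y →
      FreeAlgebra.lift ℚ (fun D : UTDiagram => w D.legs D.verts) x =
        FreeAlgebra.lift ℚ (fun D : UTDiagram => w D.legs D.verts) y := by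
    intro x y h
    cases h with
    | iso D D' h =>
      obtain ⟨f, hf, ho, hl, vs, hvs, hcyc⟩ := h
      rw [FreeAlgebra.lift_ι_apply, FreeAlgebra.lift_ι_apply, hl,
        hw.rename f D.legs D.verts D'.verts vs hf ho D.isClosedDiagram hvs hcyc]
    | one D hl hv => rw [FreeAlgebra.lift_ι_apply, hl, hv, hw.nil, map_one]
    | mul D₁ D₂ D hl hv =>
      rw [map_mul, FreeAlgebra.lift_ι_apply, FreeAlgebra.lift_ι_apply, FreeAlgebra.lift_ι_apply,
        hl, hv, hw.append _ _ _ _ D₁.isClosedDiagram D₂.isClosedDiagram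
          (UTDiagram.disjoint_edgeNames hl hv)]
    | basePoint D D' x l hl hl' hv' =>
      rw [FreeAlgebra.lift_ι_apply, FreeAlgebra.lift_ι_apply, hl, hl', hv',
        hw.rotate x l _ (hl ▸ D.isClosedDiagram)]
    | stu S T U l₁ l₂ a b c vs hS hS' hT hT' hU hU' =>
      have hn := S.nodup
      rw [hS, hS'] at hn
      rw [map_sub, FreeAlgebra.lift_ι_apply, FreeAlgebra.lift_ι_apply, FreeAlgebra.lift_ι_apply,
        hS, hS', hT, hT', hU, hU', hw.stu _ _ _ _ _ _ hn]
    | isolated h D l₁ l₂ x hl =>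
      rw [FreeAlgebra.lift_ι_apply, hl, map_zero, hiso h _ _ _ _ (hl ▸ D.nodup)]
  refine ⟨(RingQuot.liftAlgHom ℚ ⟨_, hrel⟩).toRingHom, fun D => ?_, fun q x => ?_⟩
  · refine (RingQuot.liftAlgHom_mkAlgHom_apply ℚ _ hrel _).trans ?_
    rw [FreeAlgebra.lift_ι_apply]
  · exact map_smul (RingQuot.liftAlgHom ℚ ⟨_, hrel⟩) q x

end DiagramAlgebra

/-! ### Schur's lemma -/

section Schur

variable {K 𝔤 : Type*} [Field K] [LieRing 𝔤] [LieAlgebra K 𝔤]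

/-- The inclusion of a Lie algebra in its enveloping algebra, as a linear map. -/
noncomputable def envelopingIota : 𝔤 →ₗ[K] UniversalEnvelopingAlgebra K 𝔤 :=
  letI : LieRing (UniversalEnvelopingAlgebra K 𝔤) := LieRing.ofAssociativeRing
  (UniversalEnvelopingAlgebra.ι K : 𝔤 →ₗ⁅K⁆ UniversalEnvelopingAlgebra K 𝔤)

theorem envelopingIota_lie (x y : 𝔤) : envelopingIota (K := K) ⁅x, y⁆ =
    envelopingIota x * envelopingIota y - envelopingIota y * envelopingIota x := by
  let _ : LieRing (UniversalEnvelopingAlgebra K 𝔤) := LieRing.ofAssociativeRing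
  exact (UniversalEnvelopingAlgebra.ι K : 𝔤 →ₗ⁅K⁆ UniversalEnvelopingAlgebra K 𝔤).map_lie x y

/-- The enveloping algebra is a quotient of the tensor algebra, hence generated by `𝔤`. -/
theorem mem_center_of_commute {u : UniversalEnvelopingAlgebra K 𝔤}
    (h : ∀ z : 𝔤, envelopingIota z * u = u * envelopingIota z) :
    u ∈ Subalgebra.center K (UniversalEnvelopingAlgebra K 𝔤) := by
  rw [Subalgebra.mem_center_iff]
  intro y
  obtain ⟨t, rfl⟩ : ∃ t, UniversalEnvelopingAlgebra.mkAlgHom K 𝔤 t = y := Quotient.exists_rep y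
  induction t using TensorAlgebra.induction with
  | algebraMap r => rw [AlgHom.commutes, Algebra.commutes]
  | ι x => exact h x
  | mul a b ha hb => rw [map_mul, mul_assoc, hb, ← mul_assoc, ha, mul_assoc]
  | add a b ha hb => rw [map_add, add_mul, mul_add, ha, hb]

variable (V : Type*) [AddCommGroup V] [Module K V] [LieRingModule 𝔤 V] [LieModule K 𝔤 V]

theorem envelopingAction_iota (x : 𝔤) :
    envelopingAction V (envelopingIota (K := K) x) = LieModule.toEnd K 𝔤 V x :=
  UniversalEnvelopingAlgebra.lift_ι_apply K _ x

/-- Schur's lemma: an eigenvalue exists over `K`, its eigenspace is a submodule because `u` is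
central, and irreducibility makes it all of `V`. -/
theorem exists_eq_algebraMap_of_mem_center [IsAlgClosed K] [FiniteDimensional K V]
    [LieModule.IsIrreducible K 𝔤 V] {u : UniversalEnvelopingAlgebra K 𝔤}
    (hu : u ∈ Subalgebra.center K (UniversalEnvelopingAlgebra K 𝔤)) :
    ∃ c : K, envelopingAction V u = algebraMap K (Module.End K V) c := by
  have := LieModule.nontrivial_of_isIrreducible K 𝔤 V
  obtain ⟨c, hc⟩ := Module.End.exists_eigenvalue (envelopingAction V u)
  have hcomm : ∀ x : 𝔤, ∀ v : V, envelopingAction V u ⁅x, v⁆ = ⁅x, envelopingAction V u v⁆ := by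
    intro x v
    have h := congrArg (envelopingAction V) (Subalgebra.mem_center_iff.1 hu (envelopingIota x))
    rw [map_mul, map_mul, envelopingAction_iota] at h
    exact (LinearMap.congr_fun h v).symm
  let N : LieSubmodule K 𝔤 V :=
    { Module.End.eigenspace (envelopingAction V u) c with
      lie_mem := by
        intro x v hv
        have hv' : envelopingAction V u v = c • v := Module.End.mem_eigenspace_iff.1 hv
        refine Module.End.mem_eigenspace_iff.2 ?_
        rw [hcomm, hv', lie_smul] }
  have hN : N = ⊤ := (eq_bot_or_eq_top N).resolve_left fun h =>
    hc (congrArg LieSubmodule.toSubmodule h)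
  refine ⟨c, LinearMap.ext fun v => ?_⟩
  have hv : v ∈ N := hN ▸ LieSubmodule.mem_top v
  rw [Module.algebraMap_end_apply]
  exact Module.End.mem_eigenspace_iff.1 hv

/-- As `V` is nonzero, a scalar is determined by its action, so the scalars inherit sums and
products from the operators. -/
theorem exists_centralCharacter [IsAlgClosed K] [FiniteDimensional K V]
    [LieModule.IsIrreducible K 𝔤 V] :
    ∃ χ : Subalgebra.center K (UniversalEnvelopingAlgebra K 𝔤) →+* K,
      ∀ u, envelopingAction V u.1 = algebraMap K (Module.End K V) (χ u) := by
  have := LieModule.nontrivial_of_isIrreducible K 𝔤 V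
  have hinj := (algebraMap K (Module.End K V)).injective
  choose χ hχ using fun u : Subalgebra.center K (UniversalEnvelopingAlgebra K 𝔤) =>
    exists_eq_algebraMap_of_mem_center V u.2
  refine ⟨⟨⟨⟨χ, hinj ?_⟩, fun u v => hinj ?_⟩, hinj ?_, fun u v => hinj ?_⟩, hχ⟩
  · rw [← hχ, map_one]; exact map_one _
  · rw [map_mul, ← hχ, ← hχ, ← hχ]; exact map_mul _ _ _
  · rw [← hχ, map_zero]; exact map_zero _
  · rw [map_add, ← hχ, ← hχ, ← hχ]; exact map_add _ _ _

end Schur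

/-! ### Rationality -/

section Rationality

variable {K 𝔤 : Type*} [Field K] [CharZero K] [LieRing 𝔤] [LieAlgebra K 𝔤] {d : ℕ}

/-- A vector with rational coordinates. -/
def IsRationalVector (b : Module.Basis (Fin d) K 𝔤) (x : 𝔤) : Prop :=
  ∀ k, b.repr x k ∈ (algebraMap ℚ K).range

variable {b : Module.Basis (Fin d) K 𝔤}

theorem isRationalVector_basis (i : Fin d) : IsRationalVector b (b i) := by
  intro k
  rw [b.repr_self, Finsupp.single_apply]
  split_ifs
  · exact one_mem _
  · exact zero_mem _

/-- `T` is only a subgroup stable under rational scalars, so that it can be the rationals inside `K`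
as well as `rationalAction v`. -/
theorem IsRationalVector.map_mem {M : Type*} [AddCommGroup M] [Module K M] {T : AddSubgroup M}
    (f : 𝔤 →ₗ[K] M) (hT : ∀ a ∈ (algebraMap ℚ K).range, ∀ m ∈ T, a • m ∈ T)
    (hf : ∀ i, f (b i) ∈ T) {x : 𝔤} (hx : IsRationalVector b x) : f x ∈ T := by
  rw [← b.sum_repr x, map_sum]
  refine sum_mem fun i _ => ?_
  rw [map_smul]
  exact hT _ (hx i) _ (hf i)

theorem IsRationalVector.form_mem {B : LinearMap.BilinForm K 𝔤}
    (hb : ∀ i j, B (b i) (b j) ∈ (algebraMap ℚ K).range) {x y : 𝔤} (hx : IsRationalVector b x)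
    (hy : IsRationalVector b y) : B x y ∈ (algebraMap ℚ K).range := by
  have hT : ∀ a ∈ (algebraMap ℚ K).range, ∀ m ∈ (algebraMap ℚ K).range.toAddSubgroup,
      a • m ∈ (algebraMap ℚ K).range.toAddSubgroup := fun a ha m hm =>
    (algebraMap ℚ K).range.mul_mem ha hm
  exact hx.map_mem (B.flip y) hT fun i => hy.map_mem (B (b i)) hT (hb i)

theorem IsRationalVector.lie (hb : ∀ i j, IsRationalVector b ⁅b i, b j⁆) {x y : 𝔤}
    (hx : IsRationalVector b x) (hy : IsRationalVector b y) : IsRationalVector b ⁅x, y⁆ := by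
  intro k
  have hT : ∀ a ∈ (algebraMap ℚ K).range, ∀ m ∈ (algebraMap ℚ K).range.toAddSubgroup,
      a • m ∈ (algebraMap ℚ K).range.toAddSubgroup := fun a ha m hm =>
    (algebraMap ℚ K).range.mul_mem ha hm
  have h1 : ∀ i, b.coord k ⁅b i, y⁆ ∈ (algebraMap ℚ K).range.toAddSubgroup := fun i =>
    hy.map_mem (b.coord k ∘ₗ (LieModule.toEnd K 𝔤 𝔤 (b i))) hT fun j => hb i j k
  exact hx.map_mem (b.coord k ∘ₗ (LieModule.toEnd K 𝔤 𝔤 : 𝔤 →ₗ[K] Module.End K 𝔤).flip y) hT h1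

/-- The coordinates of the dual basis form the inverse of the Gram matrix of `b`, and the inverse of
a rational matrix is rational. -/
theorem isRationalVector_dualBasis {B : LinearMap.BilinForm K 𝔤} (hB : B.Nondegenerate)
    (hb : ∀ i j, B (b i) (b j) ∈ (algebraMap ℚ K).range) (i : Fin d) :
    IsRationalVector b (B.dualBasis hB b i) := by
  choose G hG using hb
  let P : Matrix (Fin d) (Fin d) K :=
    Matrix.of fun i k => b.repr (B.dualBasis hB b i) k
  have hP : P * (algebraMap ℚ K).mapMatrix (Matrix.of G) = 1 := by
    ext i j
    have h := B.apply_dualBasis_left hB b i j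
    conv_lhs at h => rw [← b.sum_repr (B.dualBasis hB b i)]
    simp only [map_sum, map_smul, LinearMap.sum_apply, LinearMap.smul_apply, smul_eq_mul,
      ← hG] at h
    simp only [Matrix.mul_apply, RingHom.mapMatrix_apply, Matrix.map_apply, Matrix.of_apply, P, h,
      Matrix.one_apply, eq_comm (a := j)]
  have hdet : IsUnit (Matrix.of G).det := by
    rw [isUnit_iff_ne_zero]
    intro h0
    have := congrArg Matrix.det hP
    rw [Matrix.det_mul, ← RingHom.map_det, h0, map_zero, mul_zero, Matrix.det_one] at this
    exact zero_ne_one this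
  have hPG : P = (algebraMap ℚ K).mapMatrix (Matrix.of G)⁻¹ := by
    calc P = P * (algebraMap ℚ K).mapMatrix (Matrix.of G * (Matrix.of G)⁻¹) := by
          rw [Matrix.mul_nonsing_inv _ hdet, map_one, mul_one]
      _ = _ := by rw [map_mul, ← mul_assoc, hP, one_mul]
  intro k
  exact ⟨_, (congrFun (congrFun hPG i) k).symm⟩

/-! ### Elements of the enveloping algebra acting by rational matrices. -/

variable {V : Type*} [AddCommGroup V] [Module K V] [LieRingModule 𝔤 V] [LieModule K 𝔤 V] {m : ℕ}

/-- The elements of the enveloping algebra that act by rational matrices. -/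
noncomputable def rationalAction (v : Module.Basis (Fin m) K V) :
    Subring (UniversalEnvelopingAlgebra K 𝔤) :=
  ((algebraMap ℚ K).mapMatrix : Matrix (Fin m) (Fin m) ℚ →+* Matrix (Fin m) (Fin m) K).range.comap
    ((LinearMap.toMatrixAlgEquiv v).toAlgHom.comp (envelopingAction V)).toRingHom

variable {v : Module.Basis (Fin m) K V}

theorem mem_rationalAction {u : UniversalEnvelopingAlgebra K 𝔤} :
    u ∈ rationalAction v ↔ ∀ s t, v.repr (envelopingAction V u (v s)) t ∈ (algebraMap ℚ K).range := by
  constructor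
  · rintro ⟨q, hq⟩ s t
    refine ⟨q t s, ?_⟩
    rw [← LinearMap.toMatrixAlgEquiv_apply]
    exact congrFun (congrFun hq t) s
  · intro h
    choose q hq using h
    refine ⟨fun t s => q s t, ?_⟩
    ext t s
    exact (hq s t).trans (LinearMap.toMatrixAlgEquiv_apply v _ t s).symm

theorem smul_mem_rationalAction {a : K} (ha : a ∈ (algebraMap ℚ K).range)
    {u : UniversalEnvelopingAlgebra K 𝔤} (hu : u ∈ rationalAction v) :
    a • u ∈ rationalAction v := by
  rw [mem_rationalAction] at hu ⊢
  intro s t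
  rw [map_smul, LinearMap.smul_apply, map_smul]
  exact mul_mem ha (hu s t)

theorem IsRationalVector.iota_mem
    (hb : ∀ i s t, v.repr ⁅b i, v s⁆ t ∈ (algebraMap ℚ K).range) {x : 𝔤}
    (hx : IsRationalVector b x) : envelopingIota x ∈ rationalAction v :=
  hx.map_mem (T := (rationalAction v).toAddSubgroup) envelopingIota
    (fun _ ha _ hm => smul_mem_rationalAction ha hm)
    fun i => mem_rationalAction.2 fun s t => by
      rw [envelopingAction_iota]
      exact hb i s t

theorem diagramWeight_mem_rationalAction {B : LinearMap.BilinForm K 𝔤} (hB : B.Nondegenerate)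
    (h1 : ∀ i j, IsRationalVector b ⁅b i, b j⁆)
    (h2 : ∀ i j, B (b i) (b j) ∈ (algebraMap ℚ K).range)
    (h3 : ∀ i s t, v.repr ⁅b i, v s⁆ t ∈ (algebraMap ℚ K).range) (legs : List HalfEdge)
    (verts : List TriVertex) : diagramWeight hB b legs verts ∈ rationalAction v := by
  have hend : ∀ c x, IsRationalVector b (endVector hB b (edgeNames legs verts) c x) := by
    intro c x
    unfold endVector
    split_ifs
    · exact isRationalVector_basis _
    · exact isRationalVector_dualBasis hB h2 _
    · exact fun k => by simp
  refine sum_mem fun c _ => smul_mem_rationalAction ?_ ?_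
  · refine Subring.list_prod_mem _ fun a ha => ?_
    obtain ⟨w, -, rfl⟩ := List.mem_map.1 ha
    exact ((hend c _).lie h1 (hend c _)).form_mem h2 (hend c _)
  · refine Subring.list_prod_mem _ fun a ha => ?_
    obtain ⟨x, -, rfl⟩ := List.mem_map.1 ha
    exact (hend c x).iota_mem h3

end Rationality

/-! ### The weight systems of a Lie algebra -/

section LieWeights

variable {K 𝔤 : Type*} [Field K] [LieRing 𝔤] [LieAlgebra K 𝔤] {d : ℕ}
  {B : LinearMap.BilinForm K 𝔤}

/-- The zero background of `closedWeight` is the default value of `endVector` off the edges, so the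
two agree by definition. -/
theorem diagramWeight_eq_closedWeight (hB : B.Nondegenerate) (b : Module.Basis (Fin d) K 𝔤) :
    diagramWeight hB b =
      closedWeight B envelopingIota fun _ s i => if s = true then b i else B.dualBasis hB b i :=
  rfl

theorem deframedWeight_eq_deframed (hB : B.Nondegenerate) (b : Module.Basis (Fin d) K 𝔤) :
    deframedWeight hB b =
      deframed (diagramWeight hB b [(0, true), (0, false)] []) (diagramWeight hB b) :=
  rfl

theorem isCasimirPair_standard (hB : B.Nondegenerate) (hsymm : B.IsSymm)
    (b : Module.Basis (Fin d) K 𝔤) :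
    IsCasimirPair B (fun i => if true = true then b i else B.dualBasis hB b i)
      (fun i => if false = true then b i else B.dualBasis hB b i) := by
  simpa using isCasimirPair_dualBasis hB hsymm b

theorem diagramWeight_eq_of_basis (hB : B.Nondegenerate) (hsymm : B.IsSymm)
    (b b' : Module.Basis (Fin d) K 𝔤) {legs : List HalfEdge} {verts : List TriVertex}
    (hD : IsClosedDiagram legs verts) :
    diagramWeight hB b legs verts = diagramWeight hB b' legs verts := by
  rw [diagramWeight_eq_closedWeight, diagramWeight_eq_closedWeight]
  exact closedWeight_eq_of_isCasimirPair hsymm (fun _ => isCasimirPair_standard hB hsymm b)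
    (fun _ => isCasimirPair_standard hB hsymm b') hD

theorem deframedWeight_eq_of_basis (hB : B.Nondegenerate) (hsymm : B.IsSymm)
    (b b' : Module.Basis (Fin d) K 𝔤) {legs : List HalfEdge} {verts : List TriVertex}
    (hD : IsClosedDiagram legs verts) :
    deframedWeight hB b legs verts = deframedWeight hB b' legs verts := by
  refine Finset.sum_congr rfl fun S hS => ?_
  rw [diagramWeight_eq_of_basis hB hsymm b b' isClosedDiagram_chord,
    diagramWeight_eq_of_basis hB hsymm b b' (hD.filter (Finset.mem_powerset.1 hS))]

theorem diagramWeight_mem_center (hB : B.Nondegenerate) (hsymm : B.IsSymm)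
    (hinv : B.lieInvariant 𝔤) (b : Module.Basis (Fin d) K 𝔤) {legs : List HalfEdge}
    {verts : List TriVertex} (hD : IsClosedDiagram legs verts) :
    diagramWeight hB b legs verts ∈ Subalgebra.center K (UniversalEnvelopingAlgebra K 𝔤) := by
  rw [diagramWeight_eq_closedWeight]
  exact mem_center_of_commute fun z => closedWeight_commute envelopingIota_lie hsymm hinv
    (fun _ => isCasimirPair_standard hB hsymm b) hD z

theorem deframedWeight_mem_center (hB : B.Nondegenerate) (hsymm : B.IsSymm)
    (hinv : B.lieInvariant 𝔤) (b : Module.Basis (Fin d) K 𝔤) {legs : List HalfEdge}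
    {verts : List TriVertex} (hD : IsClosedDiagram legs verts) :
    deframedWeight hB b legs verts ∈ Subalgebra.center K (UniversalEnvelopingAlgebra K 𝔤) :=
  sum_mem fun _ hS => mul_mem
    (pow_mem (neg_mem (diagramWeight_mem_center hB hsymm hinv b isClosedDiagram_chord)) _)
    (diagramWeight_mem_center hB hsymm hinv b (hD.filter (Finset.mem_powerset.1 hS)))

theorem isDiagramWeight_diagramWeight [CharZero K] (hB : B.Nondegenerate) (hsymm : B.IsSymm)
    (hinv : B.lieInvariant 𝔤) (b : Module.Basis (Fin d) K 𝔤) :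
    IsDiagramWeight (diagramWeight hB b) := by
  have hp := fun _ : ℕ => isCasimirPair_standard hB hsymm b
  rw [diagramWeight_eq_closedWeight]
  exact
    { rename := fun _ _ _ _ _ hf ho hD hvs hcyc =>
        closedWeight_rename hsymm hinv hp hf ho hD hvs hcyc
      nil := closedWeight_nil
      append := fun _ _ _ _ _ _ hE => closedWeight_append hE
      rotate := fun _ _ _ hD => closedWeight_rotate envelopingIota_lie hsymm hinv hp hD
      stu := fun _ _ _ _ _ _ hn => closedWeight_stu envelopingIota_lie hinv hp hn }

theorem isDiagramWeight_deframedWeight [CharZero K] (hB : B.Nondegenerate) (hsymm : B.IsSymm)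
    (hinv : B.lieInvariant 𝔤) (b : Module.Basis (Fin d) K 𝔤) :
    IsDiagramWeight (deframedWeight hB b) :=
  (isDiagramWeight_diagramWeight hB hsymm hinv b).deframed fun _ _ hD =>
    Subalgebra.mem_center_iff.1 (diagramWeight_mem_center hB hsymm hinv b hD) _

theorem deframedWeight_isolated (hB : B.Nondegenerate) (hsymm : B.IsSymm)
    (hinv : B.lieInvariant 𝔤) (b : Module.Basis (Fin d) K 𝔤) {l₁ l₂ : List HalfEdge}
    {x : HalfEdge} {vs : List TriVertex} (hn : (allEnds (l₁ ++ x :: x.opp :: l₂) vs).Nodup) :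
    deframedWeight hB b (l₁ ++ x :: x.opp :: l₂) vs = 0 := by
  rw [deframedWeight_eq_deframed, diagramWeight_eq_closedWeight]
  exact deframed_isolated (fun _ _ _ _ hn => closedWeight_isolated envelopingIota_lie hsymm hinv
    (fun _ => isCasimirPair_standard hB hsymm b) hn) hn

variable [CharZero K] [IsAlgClosed K] (V : Type*) [AddCommGroup V] [Module K V]
  [FiniteDimensional K V] [LieRingModule 𝔤 V] [LieModule K 𝔤 V] [LieModule.IsIrreducible K 𝔤 V]

/-- A central weight on diagrams gives a homomorphism from series of diagrams to power series. -/
theorem IsDiagramWeight.exists_hom {oneT : Prop}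
    {w : List HalfEdge → List TriVertex → UniversalEnvelopingAlgebra K 𝔤} (hw : IsDiagramWeight w)
    (hiso : oneT → ∀ (l₁ l₂ : List HalfEdge) (x : HalfEdge) (vs : List TriVertex),
      (allEnds (l₁ ++ x :: x.opp :: l₂) vs).Nodup → w (l₁ ++ x :: x.opp :: l₂) vs = 0)
    (hcen : ∀ legs verts, IsClosedDiagram legs verts →
      w legs verts ∈ Subalgebra.center K (UniversalEnvelopingAlgebra K 𝔤))
    (hrat : DefinedOverRat V B → ∃ v : Module.Basis (Fin (Module.finrank K V)) K V,
      ∀ legs verts, IsClosedDiagram legs verts → w legs verts ∈ rationalAction v) :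
    ∃ wg : DiagAlg oneT →ₛₗ[algebraMap ℚ K] UniversalEnvelopingAlgebra K 𝔤,
      (∀ D : UTDiagram, wg (DiagAlg.of oneT D) = w D.legs D.verts) ∧
      (∀ x, wg x ∈ Subalgebra.center K (UniversalEnvelopingAlgebra K 𝔤)) ∧
      ∃ wρ : DiagSeries oneT →ₐ[ℚ] PowerSeries K,
        (∀ (f : DiagSeries oneT) (n : ℕ),
          envelopingAction V (wg (PowerSeries.coeff n f.1)) =
            PowerSeries.coeff n (wρ f) • (1 : Module.End K V)) ∧
        (DefinedOverRat V B → ∃ wQ : DiagSeries oneT →ₐ[ℚ] PowerSeries ℚ,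
          ∀ f, PowerSeries.map (algebraMap ℚ K) (wQ f) = wρ f) := by
  obtain ⟨R, hR, hsmul⟩ := hw.exists_ringHom (K := K) hiso
  obtain ⟨χ, hχ⟩ := exists_centralCharacter (K := K) (𝔤 := 𝔤) V
  have halg : ∀ q : ℚ, R (algebraMap ℚ _ q) = algebraMap ℚ K q • 1 := fun q => by
    rw [Algebra.algebraMap_eq_smul_one, hsmul, map_one]
  have hc : ∀ x, R x ∈ Subalgebra.center K (UniversalEnvelopingAlgebra K 𝔤) := by
    intro x
    induction x using DiagAlg.induction with
    | algebraMap q => rw [halg]; exact Subalgebra.smul_mem _ (one_mem _) _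
    | of D => rw [hR]; exact hcen _ _ D.isClosedDiagram
    | mul x y hx hy => rw [map_mul]; exact mul_mem hx hy
    | add x y hx hy => rw [map_add]; exact add_mem hx hy
  -- Centrality is what permits composing with the central character; `s` is multiplicative as a
  -- composite of ring homomorphisms.
  let s : DiagAlg oneT →+* K := χ.comp (R.codRestrict _ hc)
  have hs : ∀ x, envelopingAction V (R x) = s x • (1 : Module.End K V) := fun x => by
    rw [← Algebra.algebraMap_eq_smul_one]
    exact hχ ⟨R x, hc x⟩
  -- Applying `s` to coefficients is a homomorphism on all power series over the diagram algebra;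
  -- the graded completion is a subalgebra there, so restriction suffices.
  let wρ : DiagSeries oneT →ₐ[ℚ] PowerSeries K :=
    (PowerSeries.mapAlgHom s.toRatAlgHom).comp (DiagSeries oneT).val
  have hwρ : ∀ f n, PowerSeries.coeff n (wρ f) = s (PowerSeries.coeff n f.1) := fun f n =>
    PowerSeries.coeff_map s n f.1
  refine ⟨{ toFun := R, map_add' := map_add R, map_smul' := hsmul }, hR, hc, wρ,
    fun f n => (hwρ f n).symm ▸ hs _, fun hdef => ?_⟩
  obtain ⟨v, hv⟩ := hrat hdef
  have hQ : ∀ x, R x ∈ rationalAction v := by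
    intro x
    induction x using DiagAlg.induction with
    | algebraMap q => rw [halg]; exact smul_mem_rationalAction ⟨q, rfl⟩ (one_mem _)
    | of D => rw [hR]; exact hv _ _ D.isClosedDiagram
    | mul x y hx hy => rw [map_mul]; exact mul_mem hx hy
    | add x y hx hy => rw [map_add]; exact add_mem hx hy
  have := LieModule.nontrivial_of_isIrreducible K 𝔤 V
  -- A scalar operator has its scalar at every diagonal entry; as `V` is nonzero there is one to
  -- read.
  let i : Fin (Module.finrank K V) := ⟨0, Module.finrank_pos⟩
  have hsQ : ∀ x, s x ∈ (algebraMap ℚ K).range := by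
    intro x
    have h := mem_rationalAction.1 (hQ x) i i
    rw [hs] at h
    simpa using h
  let φ : PowerSeries ℚ →ₐ[ℚ] PowerSeries K := (PowerSeries.map (algebraMap ℚ K)).toRatAlgHom
  have hφ : Function.Injective φ := PowerSeries.map_injective _ (algebraMap ℚ K).injective
  have hrange : ∀ f, wρ f ∈ φ.range := by
    intro f
    choose q hq using fun n => hsQ (PowerSeries.coeff n f.1)
    refine ⟨PowerSeries.mk q, PowerSeries.ext fun n => ?_⟩
    rw [hwρ, ← hq]
    exact (PowerSeries.coeff_map _ _ _).trans (by rw [PowerSeries.coeff_mk])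
  -- Rational power series embed in those over `K`; since `wρ` lands in the image, inverting the
  -- embedding there gives a homomorphism with no further check.
  refine ⟨(AlgEquiv.ofInjective φ hφ).symm.toAlgHom.comp (wρ.codRestrict φ.range hrange),
    fun f => ?_⟩
  exact congrArg Subtype.val
    ((AlgEquiv.ofInjective φ hφ).apply_symm_apply (wρ.codRestrict φ.range hrange f))

end LieWeights

theorem mainTheorem8 {K 𝔤 V : Type*} [Field K] [CharZero K] [IsAlgClosed K]
    [LieRing 𝔤] [LieAlgebra K 𝔤] [FiniteDimensional K 𝔤]
    (B : LinearMap.BilinForm K 𝔤) (hB : B.Nondegenerate) (hsymm : B.IsSymm)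
    (hinv : B.lieInvariant 𝔤)
    [AddCommGroup V] [Module K V] [FiniteDimensional K V] [LieRingModule 𝔤 V] [LieModule K 𝔤 V]
    [LieModule.IsIrreducible K 𝔤 V] :
    -- the weight system on diagrams modulo STU and 1T
    (∃ wg : DiagAlg True →ₛₗ[algebraMap ℚ K] UniversalEnvelopingAlgebra K 𝔤,
      (∀ (b : Module.Basis (Fin (Module.finrank K 𝔤)) K 𝔤) (D : UTDiagram),
        wg (DiagAlg.of True D) = deframedWeight hB b D.legs D.verts) ∧
      (∀ x, wg x ∈ Subalgebra.center K (UniversalEnvelopingAlgebra K 𝔤)) ∧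
      ∃ wρ : DiagSeries True →ₐ[ℚ] PowerSeries K,
        (∀ (f : DiagSeries True) (n : ℕ),
          envelopingAction V (wg (PowerSeries.coeff n f.1)) =
            PowerSeries.coeff n (wρ f) • (1 : Module.End K V)) ∧
        (DefinedOverRat V B → ∃ wQ : DiagSeries True →ₐ[ℚ] PowerSeries ℚ,
          ∀ f, PowerSeries.map (algebraMap ℚ K) (wQ f) = wρ f)) ∧
    -- its framed version, on diagrams modulo STU only
    (∃ wg : DiagAlg False →ₛₗ[algebraMap ℚ K] UniversalEnvelopingAlgebra K 𝔤,
      (∀ (b : Module.Basis (Fin (Module.finrank K 𝔤)) K 𝔤) (D : UTDiagram),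
        wg (DiagAlg.of False D) = diagramWeight hB b D.legs D.verts) ∧
      (∀ x, wg x ∈ Subalgebra.center K (UniversalEnvelopingAlgebra K 𝔤)) ∧
      ∃ wρ : DiagSeries False →ₐ[ℚ] PowerSeries K,
        (∀ (f : DiagSeries False) (n : ℕ),
          envelopingAction V (wg (PowerSeries.coeff n f.1)) =
            PowerSeries.coeff n (wρ f) • (1 : Module.End K V)) ∧
        (DefinedOverRat V B → ∃ wQ : DiagSeries False →ₐ[ℚ] PowerSeries ℚ,
          ∀ f, PowerSeries.map (algebraMap ℚ K) (wQ f) = wρ f)) := by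
  have key : DefinedOverRat V B → ∃ v : Module.Basis (Fin (Module.finrank K V)) K V,
      ∀ (b : Module.Basis (Fin (Module.finrank K 𝔤)) K 𝔤) legs verts,
        IsClosedDiagram legs verts → diagramWeight hB b legs verts ∈ rationalAction v := by
    rintro ⟨b₀, v, h1, h2, h3⟩
    refine ⟨v, fun b legs verts hD => ?_⟩
    -- Rationality is visible only in the special basis `b₀`; since the weight does not depend on
    -- the basis, it transfers to any `b`.
    rw [diagramWeight_eq_of_basis hB hsymm b b₀ hD]
    exact diagramWeight_mem_rationalAction hB h1 h2 h3 legs verts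
  let b₀ := Module.finBasis K 𝔤
  constructor
  · obtain ⟨wg, h1, h2⟩ :=
      (isDiagramWeight_deframedWeight hB hsymm hinv b₀).exists_hom (B := B) V (oneT := True)
        (fun _ _ _ _ _ hn => deframedWeight_isolated hB hsymm hinv b₀ hn)
        (fun _ _ hD => deframedWeight_mem_center hB hsymm hinv b₀ hD)
        (fun h => (key h).imp fun _ hv _ _ hD => sum_mem fun _ hS =>
          mul_mem (pow_mem (neg_mem (hv b₀ _ _ isClosedDiagram_chord)) _)
            (hv b₀ _ _ (hD.filter (Finset.mem_powerset.1 hS))))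
    exact ⟨wg, fun b D => (h1 D).trans
      (deframedWeight_eq_of_basis hB hsymm b₀ b D.isClosedDiagram), h2⟩
  · obtain ⟨wg, h1, h2⟩ :=
      (isDiagramWeight_diagramWeight hB hsymm hinv b₀).exists_hom (B := B) V (oneT := False)
        (fun h => h.elim) (fun _ _ hD => diagramWeight_mem_center hB hsymm hinv b₀ hD)
        (fun h => (key h).imp fun _ hv => hv b₀)
    exact ⟨wg, fun b D => (h1 D).trans
      (diagramWeight_eq_of_basis hB hsymm b₀ b D.isClosedDiagram), h2⟩
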